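/- Let $n\geq 2$ and let $(M^{2n},g,J)$ be a Kaehler manifold of real dimension $2n$, that is, a smooth manifold with a smooth Riemannian metric $g$ and a smooth field $J$ of endomorphisms of the tangent spaces such that $J^2=-I$, $g(JX,JY)=g(X,Y)$ for all tangent vectors $X,Y$ at the same point, and $\nabla J=0$ for the Levi-Civita connection $\nabla$ of $g$. Suppose that there is a point $p\in M^{2n}$ at which all holomorphic sectional curvatures are positive, that is, the sectional curvature satisfies $K(X,JX)>0$ for every $0\neq X\in T_pM$. Then there is no (smooth) isometric immersion of $M^{2n}$ into the hyperbolic space $\mathbb{H}^{3n-1}$ of constant sectional curvature $-1$. -/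

import Mathlib

open scoped Manifold ContDiff

noncomputable section

/-! ### Riemannian metrics and endomorphism fields on a smooth manifold -/

section Riemannian

/-- Smooth Riemannian metrics on the `d`-dimensional smooth manifold `M`. -/
abbrev SmoothMetric (d : ℕ) (M : Type*) [TopologicalSpace M]
    [ChartedSpace (EuclideanSpace ℝ (Fin d)) M] [IsManifold (𝓡 d) ∞ M] : Type _ :=
  Bundle.ContMDiffRiemannianMetric (𝓡 d) ∞ (EuclideanSpace ℝ (Fin d))
    (fun x : M => TangentSpace (𝓡 d) x)

/-- Smooth fields of endomorphisms of the tangent spaces, that is, smooth `(1,1)`-tensor fields. -/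
abbrev SmoothEndField (d : ℕ) (M : Type*) [TopologicalSpace M]
    [ChartedSpace (EuclideanSpace ℝ (Fin d)) M] [IsManifold (𝓡 d) ∞ M] : Type _ :=
  ContMDiffSection (𝓡 d) (EuclideanSpace ℝ (Fin d) →L[ℝ] EuclideanSpace ℝ (Fin d)) ∞
    (fun x : M => TangentSpace (𝓡 d) x →L[ℝ] TangentSpace (𝓡 d) x)

/-- The partial derivative `∂_i h` of a real function on `ℝ^d`. -/
def coordDeriv {d : ℕ} (i : Fin d) (h : EuclideanSpace ℝ (Fin d) → ℝ)
    (u : EuclideanSpace ℝ (Fin d)) : ℝ :=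
  fderiv ℝ h u (EuclideanSpace.single i 1)

variable {d : ℕ} {M : Type*} [TopologicalSpace M] [ChartedSpace (EuclideanSpace ℝ (Fin d)) M]

/-- The coordinate vector `∂_i` of the chart at `x₀`, at the point with coordinates `u`. -/
def coordVec (x₀ : M) (i : Fin d) (u : EuclideanSpace ℝ (Fin d)) :
    TangentSpace (𝓡 d) ((extChartAt (𝓡 d) x₀).symm u) :=
  mfderiv 𝓘(ℝ, EuclideanSpace ℝ (Fin d)) (𝓡 d) (extChartAt (𝓡 d) x₀).symm u
    (EuclideanSpace.single i (1 : ℝ) : EuclideanSpace ℝ (Fin d))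

/-- The components `X^i` of a tangent vector `X = ∑ X^i ∂_i` in the chart at `x₀`. -/
def coordComp (x₀ : M) {x : M} (X : TangentSpace (𝓡 d) x) : EuclideanSpace ℝ (Fin d) :=
  mfderiv (𝓡 d) 𝓘(ℝ, EuclideanSpace ℝ (Fin d)) (extChartAt (𝓡 d) x₀) x X

variable [IsManifold (𝓡 d) ∞ M]

/-- The components `g_{ij} = g(∂_i, ∂_j)` of the metric in the chart at `x₀`. -/
def metricCoeff (g : SmoothMetric d M) (x₀ : M) (u : EuclideanSpace ℝ (Fin d)) :
    Matrix (Fin d) (Fin d) ℝ :=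
  Matrix.of fun i j =>
    g.inner ((extChartAt (𝓡 d) x₀).symm u) (coordVec x₀ i u) (coordVec x₀ j u)

/-- The Christoffel symbols of the Levi-Civita connection in the chart at `x₀`,
`Γ^k_{ij} = ½ ∑_l g^{kl} (∂_i g_{jl} + ∂_j g_{il} - ∂_l g_{ij})`, so `∇_{∂_i} ∂_j = Γ^k_{ij} ∂_k`. -/
def christoffel (g : SmoothMetric d M) (x₀ : M) (k i j : Fin d)
    (u : EuclideanSpace ℝ (Fin d)) : ℝ :=
  (1 / 2) * ∑ l, (metricCoeff g x₀ u)⁻¹ k l *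
    (coordDeriv i (fun v => metricCoeff g x₀ v j l) u
      + coordDeriv j (fun v => metricCoeff g x₀ v i l) u
      - coordDeriv l (fun v => metricCoeff g x₀ v i j) u)

/-- The components of the curvature tensor `R(X,Y)Z = ∇_X ∇_Y Z - ∇_Y ∇_X Z - ∇_{[X,Y]} Z` in the
chart at `x₀`: `R(∂_i, ∂_j) ∂_k = ∑_l (curvCoeff g x₀ l k i j) ∂_l`. -/
def curvCoeff (g : SmoothMetric d M) (x₀ : M) (l k i j : Fin d)
    (u : EuclideanSpace ℝ (Fin d)) : ℝ :=
  coordDeriv i (christoffel g x₀ l j k) u - coordDeriv j (christoffel g x₀ l i k) u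
    + ∑ m, (christoffel g x₀ l i m u * christoffel g x₀ m j k u
      - christoffel g x₀ l j m u * christoffel g x₀ m i k u)

/-- `⟨R(X,Y)Z, W⟩` at the point `p`, computed in the chart at `p`. -/
def riemannTensor (g : SmoothMetric d M) (p : M) (X Y Z W : TangentSpace (𝓡 d) p) : ℝ :=
  ∑ i, ∑ j, ∑ k, ∑ l, ∑ m,
    metricCoeff g p (extChartAt (𝓡 d) p p) l m
      * curvCoeff g p l k i j (extChartAt (𝓡 d) p p)
      * coordComp p X i * coordComp p Y j * coordComp p Z k * coordComp p W m

/-- The sectional curvature `K(X,Y) = ⟨R(X,Y)Y, X⟩ / (|X|²|Y|² - ⟨X,Y⟩²)` at `p` of the plane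
spanned by the linearly independent vectors `X` and `Y`. -/
def sectionalCurvature (g : SmoothMetric d M) (p : M) (X Y : TangentSpace (𝓡 d) p) : ℝ :=
  riemannTensor g p X Y Y X / (g.inner p X X * g.inner p Y Y - g.inner p X Y ^ 2)

/-- The components of an endomorphism field in the chart at `x₀`: `J ∂_j = ∑_k J^k_j ∂_k`. -/
def endCoeff (J : SmoothEndField d M) (x₀ : M) (k j : Fin d)
    (u : EuclideanSpace ℝ (Fin d)) : ℝ :=
  coordComp x₀ (J ((extChartAt (𝓡 d) x₀).symm u) (coordVec x₀ j u)) k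

/-- The components `(∇_i J)^k_j` of the covariant derivative of `J` in the chart at `x₀`. -/
def covDerivEnd (g : SmoothMetric d M) (J : SmoothEndField d M) (x₀ : M) (k i j : Fin d)
    (u : EuclideanSpace ℝ (Fin d)) : ℝ :=
  coordDeriv i (endCoeff J x₀ k j) u
    + ∑ m, (christoffel g x₀ k i m u * endCoeff J x₀ m j u
      - christoffel g x₀ m i j u * endCoeff J x₀ k m u)

/-- `(M, g, J)` is a Kaehler manifold: `J` is an almost complex structure that is orthogonal and
parallel with respect to the Levi-Civita connection of `g`. -/
structure IsKaehler (g : SmoothMetric d M) (J : SmoothEndField d M) : Prop where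
  sq_eq_neg : ∀ (x : M) (X : TangentSpace (𝓡 d) x), J x (J x X) = -X
  orthogonal : ∀ (x : M) (X Y : TangentSpace (𝓡 d) x),
    g.inner x (J x X) (J x Y) = g.inner x X Y
  parallel : ∀ (x₀ : M), ∀ u ∈ (extChartAt (𝓡 d) x₀).target, ∀ k i j : Fin d,
    covDerivEnd g J x₀ k i j u = 0

/-- All holomorphic sectional curvatures `K(X, JX)`, `0 ≠ X ∈ T_pM`, are positive. -/
def HasPosHolSecCurvAt (g : SmoothMetric d M) (J : SmoothEndField d M) (p : M) : Prop :=
  ∀ X : TangentSpace (𝓡 d) p, X ≠ 0 → 0 < sectionalCurvature g p X (J p X)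

end Riemannian

/-! ### Hyperbolic space -/

/-- The vector space `ℝ × ℝ^m` underlying the `(m+1)`-dimensional Lorentzian space; the first
coordinate is the time-like one. -/
abbrev LorentzSpace (m : ℕ) : Type := ℝ × EuclideanSpace ℝ (Fin m)

/-- The Lorentzian inner product. -/
def lorentzInner {m : ℕ} (v w : LorentzSpace m) : ℝ :=
  -(v.1 * w.1) + inner ℝ v.2 w.2

/-- Hyperbolic space `ℍ^m` of constant sectional curvature `-1`: the upper sheet of the hyperboloid
`⟨v,v⟩ = -1` in Lorentzian space, an embedded submanifold with the induced metric. -/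
def HyperbolicSpace (m : ℕ) : Set (LorentzSpace m) :=
  {v | lorentzInner v v = -1 ∧ 0 < v.1}

/-- Isometric immersions of `(M, g)` into `ℍ^m`. As `ℍ^m` is an embedded submanifold of Lorentzian
space with the induced metric, smoothness and the differential are those of the composition with
the inclusion; injectivity of the differential follows from `isometric`. -/
structure IsIsometricImmersion {d : ℕ} {M : Type*} [TopologicalSpace M]
    [ChartedSpace (EuclideanSpace ℝ (Fin d)) M] [IsManifold (𝓡 d) ∞ M]
    (g : SmoothMetric d M) {m : ℕ} (f : M → HyperbolicSpace m) : Prop where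
  smooth : ContMDiff (𝓡 d) 𝓘(ℝ, LorentzSpace m) ∞ (fun x => (f x : LorentzSpace m))
  isometric : ∀ (x : M) (X Y : TangentSpace (𝓡 d) x),
    lorentzInner
        (mfderiv (𝓡 d) 𝓘(ℝ, LorentzSpace m) (fun y => (f y : LorentzSpace m)) x X : LorentzSpace m)
        (mfderiv (𝓡 d) 𝓘(ℝ, LorentzSpace m) (fun y => (f y : LorentzSpace m)) x Y : LorentzSpace m)
      = g.inner x X Y

end

/-! View `ℍ^{3n-1}` as a hyperboloid in flat Lorentzian space of dimension `3n`. The normal space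
`N` of the immersion at `p` then has dimension `n = dim_ℂ T_pM`; it is Lorentzian, as it contains
the time-like position vector `φ`. The proof shows that the scalar product of `N` would have to be
positive semidefinite.

Let `α` be the second fundamental form in Lorentzian space. Its `(1,1)` part `B(Y,X) = α(X - iJX, Y
+ iJY)` is a Hermitian form with values in `N ⊗ ℂ`. Since `∇J = 0`, the curvature satisfies
`R(JX,JY) = R(X,Y)`, so it vanishes on pairs of `(1,0)` vectors. By the Gauss equation this says
that `B` is flat: `⟨B(Y,X), B(W,Z)⟩ = ⟨B(W,X), B(Y,Z)⟩`. Positive holomorphic curvature makes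
`B(X,X)` space-like for `X ≠ 0`.

If `B_Z = B(Z,·)` has maximal rank, then every `B_W` maps `ker B_Z` into the range of `B_Z`
(`exists_map_ker_le_range`). With flatness and space-likeness this makes `B_Z` injective, hence
bijective by the dimension count. The operators `B_W B_Z⁻¹` are self-adjoint and commute, so they
have common eigenvectors. Each of these yields a real space-like common eigenvector `B(Y,Y)`, and
splitting these off one at a time shows that all real vectors have nonnegative square
(`nonneg_of_flat_hermitian`). This contradicts `⟨φ,φ⟩ = -1`.

The remaining analytic input is the Gauss equation (`gauss_equation`) and the commutation of
curvature with parallel `J` (`curvatureOf_comm_of_parallel`), both in a chart. -/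

/-! ### Flat Hermitian forms -/

section FlatHermitian

open Module

variable {ι : Type*} [Fintype ι]

/-- The complex symmetric bilinear form `∑ ε_a x_a y_a`. -/
noncomputable def diagForm (ε : ι → ℝ) : (ι → ℂ) →ₗ[ℂ] (ι → ℂ) →ₗ[ℂ] ℂ :=
  LinearMap.mk₂ ℂ (fun x y => ∑ a, (ε a : ℂ) * x a * y a)
    (fun x y z => by simp [mul_add, add_mul, Finset.sum_add_distrib])
    (fun c x y => by simp only [Pi.smul_apply, smul_eq_mul, Finset.mul_sum]; congr 1; ext; ring)
    (fun x y z => by simp [mul_add, Finset.sum_add_distrib])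
    (fun c x y => by simp only [Pi.smul_apply, smul_eq_mul, Finset.mul_sum]; congr 1; ext; ring)

theorem diagForm_apply (ε : ι → ℝ) (x y : ι → ℂ) :
    diagForm ε x y = ∑ a, (ε a : ℂ) * x a * y a := rfl

theorem diagForm_comm (ε : ι → ℝ) (x y : ι → ℂ) : diagForm ε x y = diagForm ε y x := by
  simp only [diagForm_apply]; congr 1; ext; ring

theorem diagForm_eq_zero [DecidableEq ι] {ε : ι → ℝ} (hε : ∀ a, ε a ≠ 0) {x : ι → ℂ}
    (h : ∀ y, diagForm ε x y = 0) : x = 0 := by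
  ext a
  have := h (Pi.single a 1)
  simpa [diagForm_apply, Pi.single_apply, hε a] using this

theorem diagForm_star (ε : ι → ℝ) (x y : ι → ℂ) :
    diagForm ε (star x) (star y) = star (diagForm ε x y) := by
  simp [diagForm_apply]

/-- A commuting family of endomorphisms has a common eigenvector in each nonzero invariant
subspace. -/
theorem exists_common_eigenvector {L κ : Type*} [AddCommGroup L] [Module ℂ L]
    [FiniteDimensional ℂ L] (D : κ → End ℂ L) (hD : ∀ i j x, D i (D j x) = D j (D i x))
    (T : Submodule ℂ L) (hT : T ≠ ⊥) (hinv : ∀ i, ∀ x ∈ T, D i x ∈ T) :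
    ∃ ξ ∈ T, ξ ≠ 0 ∧ ∀ i, ∃ c : ℂ, D i ξ = c • ξ := by
  induction h : finrank ℂ T using Nat.strong_induction_on generalizing T with
  | _ k ih =>
    by_cases hs : ∀ i, ∃ c : ℂ, ∀ x ∈ T, D i x = c • x
    · obtain ⟨ξ, hξ, h0⟩ := T.exists_mem_ne_zero_of_ne_bot hT
      exact ⟨ξ, hξ, h0, fun i => (hs i).imp fun c hc => hc ξ hξ⟩
    · push Not at hs
      obtain ⟨i, hi⟩ := hs
      have : Nontrivial T := Submodule.nontrivial_iff_ne_bot.mpr hT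
      obtain ⟨c, hc⟩ := End.exists_eigenvalue ((D i).restrict (hinv i))
      obtain ⟨⟨v, hvT⟩, hv⟩ := hc.exists_hasEigenvector
      have hv1 : D i v = c • v := congrArg Subtype.val hv.apply_eq_smul
      have hv0 : v ≠ 0 := fun h0 => hv.2 (Subtype.ext h0)
      -- `D i` is not scalar on `T`, so its eigenspace cuts out a proper subspace; commutativity
      -- keeps it invariant under the whole family.
      let T' : Submodule ℂ L := T ⊓ End.eigenspace (D i) c
      have hlt : T' < T := by
        refine lt_of_le_of_ne inf_le_left fun heq => ?_
        obtain ⟨x, hx, hne⟩ := hi c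
        rw [← heq] at hx
        exact hne (End.mem_eigenspace_iff.mp hx.2)
      obtain ⟨ξ, hξ, h⟩ := ih _ (h ▸ Submodule.finrank_lt_finrank_of_lt hlt) T'
        ((Submodule.ne_bot_iff _).mpr ⟨v, ⟨hvT, End.mem_eigenspace_iff.mpr hv1⟩, hv0⟩)
        (fun j x hx => Submodule.mem_inf.mpr ⟨hinv j x hx.1, by
          rw [End.mem_eigenspace_iff, hD, End.mem_eigenspace_iff.mp hx.2, map_smul]⟩) rfl
      exact ⟨ξ, hξ.1, h⟩

/-- At a parameter `Z` of maximal rank of a semilinear family of linear maps, every other member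
of the family maps the kernel into the range. -/
theorem exists_map_ker_le_range {V L : Type*} [AddCommGroup V] [Module ℂ V]
    [NormedAddCommGroup L] [NormedSpace ℂ L] [FiniteDimensional ℂ L]
    (B : V →ₗ⋆[ℂ] V →ₗ[ℂ] L) :
    ∃ Z, ∀ W U, B Z U = 0 → B W U ∈ LinearMap.range (B Z) := by
  obtain ⟨Z, hZ⟩ : ∃ Z, ∀ W, finrank ℂ (LinearMap.range (B W)) ≤
      finrank ℂ (LinearMap.range (B Z)) := by
    have hfin : (Set.range fun W => finrank ℂ (LinearMap.range (B W))).Finite :=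
      (Set.finite_Iic (finrank ℂ L)).subset (by
        rintro _ ⟨W, rfl⟩; exact Submodule.finrank_le _)
    obtain ⟨_, ⟨Z, rfl⟩, hZ⟩ := hfin.exists_maximal ⟨_, ⟨0, rfl⟩⟩
    refine ⟨Z, fun W => ?_⟩
    rcases le_total (finrank ℂ (LinearMap.range (B W))) (finrank ℂ (LinearMap.range (B Z)))
      with h | h
    · exact h
    · exact hZ ⟨W, rfl⟩ h
  refine ⟨Z, fun W U hU => ?_⟩
  by_contra hn
  let b := finBasis ℂ (LinearMap.range (B Z))
  choose y hy using fun i => (b i).2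
  -- Perturb `Z` to `Z + tW`. These rank-plus-one vectors are independent at `t = 0`, hence for
  -- small `t`. For `t ≠ 0` all lie in the range of `B (Z + tW)`, because `B Z U = 0` gives `B W U =
  -- t⁻¹ B (Z + tW) U`. Taking `t` real makes conjugate-linearity harmless.
  let c : ℝ → Fin (finrank ℂ (LinearMap.range (B Z)) + 1) → L := fun t =>
    Fin.cons (B W U) fun i => B Z (y i) + (t : ℂ) • B W (y i)
  have hc0 : LinearIndependent ℂ (c 0) := by
    have hfam : (fun i => B Z (y i) + ((0 : ℝ) : ℂ) • B W (y i)) =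
        Subtype.val ∘ b := by
      ext i; simp [hy]
    simp only [c, hfam]
    refine linearIndependent_finCons.mpr ⟨?_, fun h => hn ?_⟩
    · exact b.linearIndependent.map' (LinearMap.range (B Z)).subtype (by simp)
    · refine Submodule.span_le.mpr ?_ h
      rintro _ ⟨i, rfl⟩
      exact (b i).2
  have hcont : Continuous c := by
    refine continuous_pi fun i => ?_
    refine Fin.cases ?_ (fun i => ?_) i
    · exact continuous_const
    · simp only [c, Fin.cons_succ]; fun_prop
  have hev : ∀ᶠ t in nhds (0 : ℝ), LinearIndependent ℂ (c t) :=
    hcont.continuousAt.eventually (isOpen_setOfPred_linearIndependent.mem_nhds hc0)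
  obtain ⟨t, ht, ht0⟩ := ((hev.filter_mono nhdsWithin_le_nhds).and
    (self_mem_nhdsWithin : {(0 : ℝ)}ᶜ ∈ nhdsWithin 0 {(0 : ℝ)}ᶜ)).exists
  have ht0' : (t : ℂ) ≠ 0 := by simpa using ht0
  have hB : ∀ x, B (Z + (t : ℂ) • W) x = B Z x + (t : ℂ) • B W x := fun x => by
    rw [map_add, LinearMap.map_smulₛₗ, Complex.conj_ofReal]; rfl
  have hmem : ∀ i, c t i ∈ LinearMap.range (B (Z + (t : ℂ) • W)) := by
    refine Fin.cases ?_ fun i => ?_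
    · refine ⟨(t : ℂ)⁻¹ • U, ?_⟩
      rw [map_smul, hB, hU, zero_add, smul_smul, inv_mul_cancel₀ ht0', one_smul]
      rfl
    · exact ⟨y i, hB _⟩
  have hli : LinearIndependent ℂ (fun i => (⟨c t i, hmem i⟩ :
      LinearMap.range (B (Z + (t : ℂ) • W)))) :=
    LinearIndependent.of_comp (LinearMap.range (B (Z + (t : ℂ) • W))).subtype ht
  have := hli.fintype_card_le_finrank
  rw [Fintype.card_fin] at this
  exact absurd (hZ (Z + (t : ℂ) • W)) (by omega)

/-- A flat Hermitian form on `V` with values in the complexification of a space of dimension at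
most `dim V` whose diagonal values are all space-like forces the target to be positive. -/
theorem nonneg_of_flat_hermitian [DecidableEq ι] {V : Type*} [AddCommGroup V] [Module ℂ V]
    [FiniteDimensional ℂ V] {ε : ι → ℝ} (hε : ∀ a, ε a ≠ 0)
    (hcard : Fintype.card ι ≤ finrank ℂ V) (B : V →ₗ⋆[ℂ] V →ₗ[ℂ] (ι → ℂ))
    (hherm : ∀ X Y, B X Y = star (B Y X))
    (hflat : ∀ X Y Z W, diagForm ε (B Y X) (B W Z) = diagForm ε (B W X) (B Y Z))
    (hpos : ∀ X, X ≠ 0 → 0 < (diagForm ε (B X X) (B X X)).re) (a : ι) : 0 ≤ ε a := by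
  obtain ⟨Z, hZ⟩ := exists_map_ker_le_range B
  have hinj : Function.Injective (B Z) := by
    rw [← LinearMap.ker_eq_bot, LinearMap.ker_eq_bot']
    intro U hU
    by_contra h0
    -- With `B U U = B Z Y`, flatness gives `⟨B U U, B Z Y⟩ = ⟨B Z U, B U Y⟩ = 0`, against the
    -- positivity of `B U U`.
    obtain ⟨Y, hY⟩ := hZ U U hU
    have h := hflat U U Y Z
    rw [hY, hU] at h
    have := hpos U h0
    rw [h] at this
    simp at this
  have hdim : finrank ℂ V = finrank ℂ (ι → ℂ) :=
    le_antisymm (LinearMap.finrank_le_finrank_of_injective hinj) (by simpa using hcard)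
  let e : V ≃ₗ[ℂ] (ι → ℂ) := LinearEquiv.ofInjectiveOfFinrankEq (B Z) hinj hdim
  have he : ∀ y, e y = B Z y := fun y => rfl
  let D : V → End ℂ (ι → ℂ) := fun W => B W ∘ₗ e.symm.toLinearMap
  have hDe : ∀ W y, D W (e y) = B W y := fun W y => by simp [D]
  have hsym : ∀ W x y, diagForm ε (D W x) y = diagForm ε x (D W y) := fun W x y => by
    obtain ⟨x, rfl⟩ := e.surjective x
    obtain ⟨y, rfl⟩ := e.surjective y
    rw [hDe, hDe, he, he, hflat]
  have hcomm : ∀ W X x, D W (D X x) = D X (D W x) := fun W X x => by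
    rw [← sub_eq_zero]
    refine diagForm_eq_zero hε fun y => ?_
    rw [map_sub, LinearMap.sub_apply, hsym W (D X x), hsym X (D W x), sub_eq_zero]
    obtain ⟨x, rfl⟩ := e.surjective x
    obtain ⟨y, rfl⟩ := e.surjective y
    rw [hDe, hDe, hDe, hDe, hflat]
  -- Induction on the dimension of an invariant subspace. `T` need not be closed under conjugation;
  -- only the tested vector `v` is real.
  have key : ∀ T : Submodule ℂ (ι → ℂ), (∀ W, ∀ x ∈ T, D W x ∈ T) →
      ∀ v ∈ T, star v = v → 0 ≤ (diagForm ε v v).re := by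
    intro T
    induction h : finrank ℂ T using Nat.strong_induction_on generalizing T with
    | _ k ih =>
      intro hinv v hv hreal
      by_cases hT : T = ⊥
      · subst hT
        rw [(Submodule.mem_bot ℂ).mp hv]; simp
      obtain ⟨ξ, hξT, hξ0, hξ⟩ := exists_common_eigenvector D hcomm T hT hinv
      obtain ⟨Y, rfl⟩ := e.surjective ξ
      choose c hc using hξ
      have hY0 : Y ≠ 0 := by rintro rfl; exact hξ0 (map_zero e)
      have hη := hpos Y hY0
      -- With `ξ = B Z Y`, the vector `η = D Y ξ` is a multiple of `ξ`, hence again a common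
      -- eigenvector in `T`. In addition it is real and has positive square.
      set η := B Y Y
      have hηD : D Y (e Y) = η := hDe Y Y
      have hηT : η ∈ T := hηD ▸ hinv Y _ hξT
      have hηreal : star η = η := (hherm Y Y).symm
      have hηe : ∀ W, D W η = c W • η := fun W => by rw [← hηD, hc Y, map_smul, hc W, smul_comm]
      have hηim : (starRingEnd ℂ) (diagForm ε η η) = diagForm ε η η := by
        have := diagForm_star ε η η
        rw [hηreal] at this
        exact this.symm
      obtain ⟨q, hq⟩ := Complex.conj_eq_iff_real.mp hηim
      have hvim : (starRingEnd ℂ) (diagForm ε v η) = diagForm ε v η := by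
        have := diagForm_star ε v η
        rw [hηreal, hreal] at this
        exact this.symm
      obtain ⟨r, hr⟩ := Complex.conj_eq_iff_real.mp hvim
      rw [hq, Complex.ofReal_re] at hη
      have hq0 : (q : ℂ) ≠ 0 := by exact_mod_cast hη.ne'
      -- The complement of an eigenvector of self-adjoint operators is invariant. Projecting `v` off
      -- `η` uses the real coefficient `r / q`, so the projection is still real, and its square is
      -- smaller by `r² / q ≥ 0`.
      let T' : Submodule ℂ (ι → ℂ) := T ⊓ LinearMap.ker (diagForm ε η)
      have hT'lt : T' < T := by
        refine lt_of_le_of_ne inf_le_left fun heq => ?_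
        have : η ∈ T' := heq ▸ hηT
        have := LinearMap.mem_ker.mp (Submodule.mem_inf.mp this).2
        rw [hq] at this
        exact hq0 this
      have hwT' : v - ((r / q : ℝ) : ℂ) • η ∈ T' := by
        refine Submodule.mem_inf.mpr ⟨T.sub_mem hv (T.smul_mem _ hηT), ?_⟩
        rw [LinearMap.mem_ker, map_sub, map_smul, diagForm_comm, hr, hq]
        push_cast
        rw [smul_eq_mul, div_mul_cancel₀ _ hq0, sub_self]
      have hw := ih _ (h ▸ Submodule.finrank_lt_finrank_of_lt hT'lt) T' rfl
        (fun W x hx => Submodule.mem_inf.mpr ⟨hinv W x hx.1, by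
          rw [LinearMap.mem_ker, ← hsym, hηe, map_smul, LinearMap.smul_apply,
            LinearMap.mem_ker.mp hx.2, smul_zero]⟩) _ hwT' (by
          rw [star_sub, star_smul, hreal, hηreal]; simp)
      have hexp : diagForm ε (v - ((r / q : ℝ) : ℂ) • η) (v - ((r / q : ℝ) : ℂ) • η) =
          diagForm ε v v - ((r ^ 2 / q : ℝ) : ℂ) := by
        simp only [map_sub, map_smul, LinearMap.sub_apply, LinearMap.smul_apply, hr, hq,
          diagForm_comm ε η v, smul_eq_mul]
        push_cast
        field_simp
        ring
      rw [hexp, Complex.sub_re, Complex.ofReal_re] at hw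
      have : 0 ≤ r ^ 2 / q := by positivity
      linarith
  have := key ⊤ (fun _ _ _ => trivial) (Pi.single a 1) trivial (by
    ext i; by_cases h : i = a
    · subst h; simp
    · simp [h])
  simpa [diagForm_apply, Pi.single_apply] using this

end FlatHermitian

/-! ### Flatness of the (1,1) part of a Kaehler-type second fundamental form -/

section KaehlerFlat

open Module

/-- A curvature tensor of Gauss type that is invariant under a complex structure `J` forces the
scalar product of the target to be positive semidefinite, if the values
`α(X,X) + α(JX,JX)`, `X ≠ 0`, are space-like and the dimension of the target is at most half that
of the source. -/
theorem nonneg_of_kaehler_gauss {V N : Type*} [AddCommGroup V] [Module ℝ V]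
    [FiniteDimensional ℝ V] [AddCommGroup N] [Module ℝ N] [FiniteDimensional ℝ N]
    (J : End ℝ V) (hJ : ∀ X, J (J X) = -X) (b : LinearMap.BilinForm ℝ N) (hb : ∀ x y, b x y = b y x)
    (hnd : b.Nondegenerate) (hdim : 2 * finrank ℝ N ≤ finrank ℝ V)
    (α : V →ₗ[ℝ] V →ₗ[ℝ] N) (hα : ∀ X Y, α X Y = α Y X)
    (hK : ∀ X Y Z W, b (α (J X) W) (α (J Y) Z) - b (α (J X) Z) (α (J Y) W)
      = b (α X W) (α Y Z) - b (α X Z) (α Y W))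
    (hpos : ∀ X, X ≠ 0 →
      0 < b (α X X + α (J X) (J X)) (α X X + α (J X) (J X))) (v : N) : 0 ≤ b v v := by
  obtain ⟨e, he⟩ := LinearMap.BilinForm.exists_orthogonal_basis (B := b) ⟨fun x y => hb x y⟩
  set ε : Fin (finrank ℝ N) → ℝ := fun a => b (e a) (e a)
  have hform : ∀ x y, b x y = ∑ a, ε a * e.repr x a * e.repr y a := fun x y => by
    conv_lhs => rw [← e.sum_repr x, ← e.sum_repr y]
    simp only [map_sum, LinearMap.sum_apply, map_smul, LinearMap.smul_apply, smul_eq_mul]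
    refine Finset.sum_congr rfl fun a _ => ?_
    rw [Finset.sum_eq_single a]
    · simp only [ε]; ring
    · intro c _ hca
      rw [show b (e c) (e a) = 0 from he hca]; simp
    · simp
  have hε : ∀ a, ε a ≠ 0 := fun a h0 => by
    have : e a = 0 := hnd.1 _ fun y => by
      rw [hform]
      refine Finset.sum_eq_zero fun c _ => ?_
      by_cases hc : c = a
      · subst hc; simp [h0]
      · simp [Ne.symm hc]
    exact e.ne_zero a this
  -- `V` becomes a complex vector space on which `i` acts as `J`.
  let ψ : ℂ →ₐ[ℝ] End ℝ V := Complex.lift ⟨J, by ext X; simp [hJ]⟩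
  let : Module ℂ V := Module.compHom V ψ.toRingHom
  have hsmul : ∀ (c : ℂ) (X : V), c • X = c.re • X + c.im • J X := fun c X => by
    change ψ c X = _
    simp [ψ, Complex.liftAux_apply, Algebra.algebraMap_eq_smul_one]
  have : IsScalarTower ℝ ℂ V := ⟨fun r c X => by simp [hsmul, smul_smul]⟩
  have : FiniteDimensional ℂ V := FiniteDimensional.right ℝ ℂ V
  have hcard : Fintype.card (Fin (finrank ℝ N)) ≤ finrank ℂ V := by
    have := Module.finrank_mul_finrank ℝ ℂ V
    rw [Complex.finrank_real_complex] at this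
    rw [Fintype.card_fin]; omega
  -- The vector `x + iy` of `N ⊗ ℂ` in the orthogonal basis `e`.
  let cpx : N → N → Fin (finrank ℝ N) → ℂ := fun x y a => ⟨e.repr x a, e.repr y a⟩
  have hdiag : ∀ x y z w, diagForm ε (cpx x y) (cpx z w) =
      ⟨b x z - b y w, b x w + b y z⟩ := fun x y z w => by
    rw [diagForm_apply]
    apply Complex.ext
    · simp only [Complex.re_sum, hform, ← Finset.sum_sub_distrib]
      refine Finset.sum_congr rfl fun a _ => ?_
      simp [cpx]
    · simp only [Complex.im_sum, hform, ← Finset.sum_add_distrib]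
      refine Finset.sum_congr rfl fun a _ => ?_
      simp [cpx]
  let P : V → V → N := fun X Y => α X Y + α (J X) (J Y)
  let Q : V → V → N := fun X Y => α X (J Y) - α (J X) Y
  -- `P + iQ` is the expansion of `α(X - iJX, Y + iJY)` for the complex bilinear extension of `α`.
  let B : V →ₗ⋆[ℂ] V →ₗ[ℂ] (Fin (finrank ℝ N) → ℂ) :=
    LinearMap.mk₂'ₛₗ (starRingEnd ℂ) (RingHom.id ℂ) (fun Y X => cpx (P X Y) (Q X Y))
      (fun X Y Z => by
        ext a; apply Complex.ext <;> simp [cpx, P, Q] <;> ring)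
      (fun c X Y => by
        ext a; apply Complex.ext <;> simp [cpx, P, Q, hsmul, hJ] <;> ring)
      (fun X Y Z => by
        ext a; apply Complex.ext <;> simp [cpx, P, Q] <;> ring)
      (fun c X Y => by
        ext a; apply Complex.ext <;> simp [cpx, P, Q, hsmul, hJ] <;> ring)
  have hB : ∀ X Y, B Y X = cpx (P X Y) (Q X Y) := fun X Y => rfl
  have hnn := nonneg_of_flat_hermitian hε hcard B
    (fun X Y => by
      rw [hB, hB]
      have h1 : P Y X = P X Y := by simp only [P]; rw [hα Y, hα (J Y)]
      have h2 : Q Y X = -Q X Y := by simp only [Q]; rw [hα Y, hα (J Y)]; abel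
      ext a
      rw [h1, h2]
      apply Complex.ext <;> simp [cpx])
    -- Flatness is the vanishing of the Gauss expression when the pair `X - iJX`, `Z - iJZ` is of
    -- type `(1,0)`. Expanded into real and imaginary parts it is a linear combination of the eight
    -- instances of `hK` below.
    (fun X Y Z W => by
      simp only [hB, hdiag]
      have k1 := hK X Z W Y
      have k2 := hK X Z (J W) (J Y)
      have k3 := hK (J X) Z (J W) Y
      have k4 := hK (J X) Z W (J Y)
      have k5 := hK X Z (J W) Y
      have k6 := hK X Z W (J Y)
      have k7 := hK (J X) Z W Y
      have k8 := hK (J X) Z (J W) (J Y)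
      simp only [hJ, map_neg, LinearMap.neg_apply] at k1 k2 k3 k4 k5 k6 k7 k8
      apply Complex.ext
      · simp only [P, Q, map_add, map_sub, LinearMap.add_apply, LinearMap.sub_apply]
        linarith
      · simp only [P, Q, map_add, map_sub, LinearMap.add_apply, LinearMap.sub_apply]
        linarith)
    (fun X hX => by
      have h0 : Q X X = 0 := by simp only [Q]; rw [hα X, sub_self]
      rw [hB, hdiag, h0]
      simpa only [map_zero, sub_zero] using hpos X hX)
  rw [hform]
  refine Finset.sum_nonneg fun a _ => ?_
  rw [mul_assoc]
  exact mul_nonneg (hnn a) (mul_self_nonneg _)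

end KaehlerFlat

/-! ### Lorentzian normal spaces -/

section LorentzGauss

open Module

/-- The Lorentzian inner product as a bilinear form. -/
noncomputable def lorentzForm (m : ℕ) : LinearMap.BilinForm ℝ (LorentzSpace m) :=
  LinearMap.mk₂ ℝ lorentzInner
    (fun x y z => by simp [lorentzInner, inner_add_left]; ring)
    (fun c x y => by simp [lorentzInner, inner_smul_left]; ring)
    (fun x y z => by simp [lorentzInner, inner_add_right]; ring)
    (fun c x y => by simp [lorentzInner, inner_smul_right]; ring)

theorem lorentzForm_apply {m : ℕ} (v w : LorentzSpace m) : lorentzForm m v w = lorentzInner v w :=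
  rfl

theorem lorentzForm_comm {m : ℕ} (v w : LorentzSpace m) : lorentzForm m v w = lorentzForm m w v := by
  simp only [lorentzForm_apply, lorentzInner, real_inner_comm v.2, mul_comm]

theorem lorentzForm_isRefl (m : ℕ) : (lorentzForm m).IsRefl := fun v w h => by
  rw [lorentzForm_comm, h]

theorem lorentzForm_nondegenerate (m : ℕ) : (lorentzForm m).Nondegenerate := by
  have key : ∀ v : LorentzSpace m, (∀ w, lorentzForm m v w = 0) → v = 0 := fun v h => by
    have h1 := h (1, 0)
    have h2 := h (0, v.2)
    simp only [lorentzForm_apply, lorentzInner, mul_one, inner_zero_right, add_zero, neg_eq_zero,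
      mul_zero, neg_zero, zero_add, inner_self_eq_zero] at h1 h2
    exact Prod.ext h1 h2
  exact ⟨key, fun v h => key v fun w => by rw [lorentzForm_comm]; exact h w⟩

/-- A vector orthogonal to a time-like vector is not time-like. -/
theorem lorentzForm_self_nonneg {m : ℕ} {v w : LorentzSpace m} (hv : lorentzForm m v v < 0)
    (hvw : lorentzForm m w v = 0) : 0 ≤ lorentzForm m w w := by
  simp only [lorentzForm_apply, lorentzInner, real_inner_self_eq_norm_sq] at hv hvw ⊢
  have hcs := abs_real_inner_le_norm w.2 v.2
  have h1 : w.1 * v.1 = inner ℝ w.2 v.2 := by linarith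
  rw [← h1] at hcs
  have h2 : (w.1 * v.1) ^ 2 ≤ (‖w.2‖ * ‖v.2‖) ^ 2 := by
    rw [← sq_abs]; exact pow_le_pow_left₀ (abs_nonneg _) hcs 2
  by_contra hneg
  have h3 : ‖w.2‖ ^ 2 < w.1 ^ 2 := by nlinarith
  have h4 : ‖v.2‖ ^ 2 < v.1 ^ 2 := by nlinarith
  have h5 : (‖w.2‖ * ‖v.2‖) ^ 2 < (w.1 * v.1) ^ 2 := by
    rw [mul_pow, mul_pow]
    exact mul_lt_mul'' h3 h4 (sq_nonneg _) (sq_nonneg _)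
  linarith

/-- There is no second fundamental form in hyperbolic space of codimension `n - 1` whose Gauss
curvature tensor on a Hermitian space of complex dimension `n` is of Kaehler type with positive
holomorphic sectional curvature. -/
theorem false_of_kaehler_gauss_lorentz {n m : ℕ} (hm : m + 1 ≤ 3 * n) {V : Type*} [AddCommGroup V]
    [Module ℝ V] [FiniteDimensional ℝ V] (hV : finrank ℝ V = 2 * n) (J : End ℝ V)
    (hJ : ∀ X, J (J X) = -X) (t : V →ₗ[ℝ] LorentzSpace m)
    (ht : ∀ X, X ≠ 0 → 0 < lorentzForm m (t X) (t X))
    (hJt : ∀ X Y, lorentzForm m (t (J X)) (t (J Y)) = lorentzForm m (t X) (t Y))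
    (α : V →ₗ[ℝ] V →ₗ[ℝ] LorentzSpace m) (hα : ∀ X Y, α X Y = α Y X)
    (hαt : ∀ X Y Z, lorentzForm m (α X Y) (t Z) = 0)
    (hK : ∀ X Y Z W, lorentzForm m (α (J X) W) (α (J Y) Z) - lorentzForm m (α (J X) Z) (α (J Y) W)
      = lorentzForm m (α X W) (α Y Z) - lorentzForm m (α X Z) (α Y W))
    (hpos : ∀ X, X ≠ 0 → 0 < lorentzForm m (α X X) (α (J X) (J X))
      - lorentzForm m (α X (J X)) (α X (J X)))
    (φ : LorentzSpace m) (hφ : lorentzForm m φ φ < 0) (hφt : ∀ X, lorentzForm m φ (t X) = 0)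
    (hαφ : ∀ X Y, lorentzForm m (α X Y) φ = -lorentzForm m (t X) (t Y)) : False := by
  have hinj : Function.Injective t := by
    rw [← LinearMap.ker_eq_bot, LinearMap.ker_eq_bot']
    intro X hX
    by_contra h0
    have := ht X h0
    simp [hX] at this
  set T : Submodule ℝ (LorentzSpace m) := LinearMap.range t with hT
  set N := (lorentzForm m).orthogonal T with hN
  have hmemN : ∀ v, (∀ X, lorentzForm m v (t X) = 0) → v ∈ N := fun v hv => by
    rw [hN, LinearMap.BilinForm.mem_orthogonal_iff]
    rintro _ ⟨X, rfl⟩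
    exact (lorentzForm_comm _ _).trans (hv X)
  have hTN : Disjoint N T := by
    rw [Submodule.disjoint_def]
    rintro _ hx ⟨X, rfl⟩
    by_contra h0
    have hX : X ≠ 0 := by rintro rfl; exact h0 (map_zero t)
    exact (ht X hX).ne' (LinearMap.BilinForm.mem_orthogonal_iff.mp hx _ ⟨X, rfl⟩)
  have hNN : (lorentzForm m).orthogonal N = T :=
    LinearMap.BilinForm.orthogonal_orthogonal (lorentzForm_nondegenerate m) (lorentzForm_isRefl m) T
  -- The tangent space `T = N^⊥` is positive definite, so it meets `N` only in zero.
  have hnd : ((lorentzForm m).restrict N).Nondegenerate :=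
    (lorentzForm m).nondegenerate_restrict_of_disjoint_orthogonal (lorentzForm_isRefl m)
      (by rwa [hNN])
  have hdimT : finrank ℝ T = 2 * n := by rw [hT, LinearMap.finrank_range_of_inj hinj, hV]
  have hdimN : finrank ℝ N = (m + 1) - 2 * n := by
    rw [hN, LinearMap.BilinForm.finrank_orthogonal (lorentzForm_nondegenerate m), hdimT]
    simp [add_comm]
  let β : V →ₗ[ℝ] V →ₗ[ℝ] N := LinearMap.mk₂ ℝ (fun X Y => ⟨α X Y, hmemN _ (hαt X Y)⟩)
    (fun X Y Z => Subtype.ext (by simp)) (fun c X Y => Subtype.ext (by simp))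
    (fun X Y Z => Subtype.ext (by simp)) (fun c X Y => Subtype.ext (by simp))
  have hφ0 := nonneg_of_kaehler_gauss J hJ ((lorentzForm m).restrict N)
    (fun x y => lorentzForm_comm _ _) hnd (by rw [hdimN, hV]; omega) β
    -- With `a = α(X,X)` and `c = α(JX,JX)`, use `|a + c|² = |a - c|² + 4⟨a,c⟩`. Since `J` is
    -- orthogonal, `hαφ` makes `a - c` and `α(X,JX)` orthogonal to the time-like `φ`, so their
    -- squares are nonnegative. By `hpos`, `⟨a,c⟩ > |α(X,JX)|² ≥ 0`.
    (fun X Y => Subtype.ext (hα X Y)) hK (fun X hX => by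
      change 0 < lorentzForm m (α X X + α (J X) (J X)) (α X X + α (J X) (J X))
      have h1 : 0 ≤ lorentzForm m (α X (J X)) (α X (J X)) := by
        refine lorentzForm_self_nonneg hφ ?_
        have := hJt X (J X)
        rw [hJ, map_neg, map_neg, lorentzForm_comm] at this
        rw [hαφ]; linarith
      have h2 : 0 ≤ lorentzForm m (α X X - α (J X) (J X)) (α X X - α (J X) (J X)) := by
        refine lorentzForm_self_nonneg hφ ?_
        rw [map_sub, LinearMap.sub_apply, hαφ, hαφ, hJt, sub_self]
      have h3 := hpos X hX
      have h4 := lorentzForm_comm (α X X) (α (J X) (J X))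
      simp only [map_add, map_sub, LinearMap.add_apply, LinearMap.sub_apply] at h2 ⊢
      linarith) ⟨φ, hmemN φ hφt⟩
  exact absurd hφ (not_lt.mpr hφ0)

end LorentzGauss

/-! ### Local computations -/

section Local

variable {d : ℕ} {F : Type*} [NormedAddCommGroup F] [NormedSpace ℝ F]

/-- The partial derivative `∂_i ψ` of a vector-valued function on `ℝ^d`. -/
noncomputable def partialDeriv (i : Fin d) (ψ : EuclideanSpace ℝ (Fin d) → F) (u : EuclideanSpace ℝ (Fin d)) :
    F :=
  fderiv ℝ ψ u (EuclideanSpace.single i 1)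

variable {O : Set (EuclideanSpace ℝ (Fin d))} {u : EuclideanSpace ℝ (Fin d)}

theorem ContDiffOn.differentiableAt_of_isOpen {ψ : EuclideanSpace ℝ (Fin d) → F}
    (hψ : ContDiffOn ℝ ∞ ψ O) (hO : IsOpen O) (hu : u ∈ O) : DifferentiableAt ℝ ψ u :=
  (hψ.contDiffAt (hO.mem_nhds hu)).differentiableAt (by simp)

theorem contDiffOn_partialDeriv (hO : IsOpen O) {ψ : EuclideanSpace ℝ (Fin d) → F}
    (hψ : ContDiffOn ℝ ∞ ψ O) (i : Fin d) : ContDiffOn ℝ ∞ (partialDeriv i ψ) O :=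
  (hψ.fderiv_of_isOpen hO (by simp)).clm_apply contDiffOn_const

theorem partialDeriv_congr (hO : IsOpen O) (hu : u ∈ O) {ψ χ : EuclideanSpace ℝ (Fin d) → F}
    (h : ∀ v ∈ O, ψ v = χ v) (i : Fin d) : partialDeriv i ψ u = partialDeriv i χ u := by
  have : ψ =ᶠ[nhds u] χ := Filter.eventually_of_mem (hO.mem_nhds hu) h
  rw [partialDeriv, partialDeriv, this.fderiv_eq]

theorem partialDeriv_comm (hO : IsOpen O) (hu : u ∈ O) {ψ : EuclideanSpace ℝ (Fin d) → F}
    (hψ : ContDiffOn ℝ ∞ ψ O) (i j : Fin d) :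
    partialDeriv i (partialDeriv j ψ) u = partialDeriv j (partialDeriv i ψ) u := by
  have hd : DifferentiableAt ℝ (fderiv ℝ ψ) u :=
    (hψ.fderiv_of_isOpen hO (m := ∞) (by simp)).differentiableAt_of_isOpen hO hu
  have hs : IsSymmSndFDerivAt ℝ ψ u :=
    (hψ.contDiffAt (hO.mem_nhds hu)).isSymmSndFDerivAt
      (by rw [minSmoothness_of_isRCLikeNormedField]; exact WithTop.coe_le_coe.mpr le_top)
  have key : ∀ i j : Fin d, partialDeriv i (partialDeriv j ψ) u =
      fderiv ℝ (fderiv ℝ ψ) u (EuclideanSpace.single i 1) (EuclideanSpace.single j 1) := by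
    intro i j
    change fderiv ℝ (fun v => fderiv ℝ ψ v (EuclideanSpace.single j 1)) u _ = _
    rw [fderiv_clm_apply hd (differentiableAt_const _)]
    simp
  rw [key, key, hs.eq]

theorem partialDeriv_bilin (b : F →L[ℝ] F →L[ℝ] ℝ) {ψ χ : EuclideanSpace ℝ (Fin d) → F}
    (hψ : DifferentiableAt ℝ ψ u) (hχ : DifferentiableAt ℝ χ u) (i : Fin d) :
    partialDeriv i (fun v => b (ψ v) (χ v)) u =
      b (partialDeriv i ψ u) (χ u) + b (ψ u) (partialDeriv i χ u) := by
  have := (b.hasFDerivAt_of_bilinear hψ.hasFDerivAt hχ.hasFDerivAt).fderiv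
  rw [partialDeriv, this]
  simp [partialDeriv, add_comm]

theorem partialDeriv_mul {ψ χ : EuclideanSpace ℝ (Fin d) → ℝ}
    (hψ : DifferentiableAt ℝ ψ u) (hχ : DifferentiableAt ℝ χ u) (i : Fin d) :
    partialDeriv i (fun v => ψ v * χ v) u =
      partialDeriv i ψ u * χ u + ψ u * partialDeriv i χ u := by
  rw [partialDeriv, fderiv_fun_mul hψ hχ]
  simp [partialDeriv]; ring

theorem partialDeriv_sub {ψ χ : EuclideanSpace ℝ (Fin d) → ℝ}
    (hψ : DifferentiableAt ℝ ψ u) (hχ : DifferentiableAt ℝ χ u) (i : Fin d) :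
    partialDeriv i (fun v => ψ v - χ v) u = partialDeriv i ψ u - partialDeriv i χ u := by
  rw [partialDeriv, fderiv_fun_sub hψ hχ]
  simp [partialDeriv]

theorem partialDeriv_sum {κ : Type*} [Fintype κ] {ψ : κ → EuclideanSpace ℝ (Fin d) → ℝ}
    (hψ : ∀ k, DifferentiableAt ℝ (ψ k) u) (i : Fin d) :
    partialDeriv i (fun v => ∑ k, ψ k v) u = ∑ k, partialDeriv i (ψ k) u := by
  rw [partialDeriv, fderiv_fun_sum fun k _ => hψ k]
  simp [partialDeriv]

theorem contDiffOn_det {k : ℕ} {A : EuclideanSpace ℝ (Fin d) → Matrix (Fin k) (Fin k) ℝ}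
    (hA : ∀ i j, ContDiffOn ℝ ∞ (fun v => A v i j) O) :
    ContDiffOn ℝ ∞ (fun v => (A v).det) O := by
  simp only [Matrix.det_apply]
  exact ContDiffOn.sum fun σ _ => (contDiffOn_prod fun i _ => hA _ _).const_smul _

theorem contDiffOn_matrix_inv {k : ℕ} {A : EuclideanSpace ℝ (Fin d) → Matrix (Fin k) (Fin k) ℝ}
    (hA : ∀ i j, ContDiffOn ℝ ∞ (fun v => A v i j) O) (hdet : ∀ v ∈ O, (A v).det ≠ 0)
    (i j : Fin k) : ContDiffOn ℝ ∞ (fun v => (A v)⁻¹ i j) O := by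
  simp only [Matrix.inv_def, Ring.inverse_eq_inv', Matrix.smul_apply, smul_eq_mul,
    Matrix.adjugate_apply]
  refine ((contDiffOn_det hA).inv hdet).mul (contDiffOn_det fun r s => ?_)
  by_cases h : r = j
  · subst h; simpa using contDiffOn_const
  · simpa [Matrix.updateRow_ne h] using hA r s

/-- The Christoffel symbols of a metric given by its components. -/
noncomputable def christoffelOf (G : EuclideanSpace ℝ (Fin d) → Matrix (Fin d) (Fin d) ℝ) (k i j : Fin d)
    (u : EuclideanSpace ℝ (Fin d)) : ℝ :=
  (1 / 2) * ∑ l, (G u)⁻¹ k l *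
    (partialDeriv i (fun v => G v j l) u + partialDeriv j (fun v => G v i l) u
      - partialDeriv l (fun v => G v i j) u)

/-- The curvature components of a connection given by its Christoffel symbols. -/
noncomputable def curvatureOf (Γ : Fin d → Fin d → Fin d → EuclideanSpace ℝ (Fin d) → ℝ) (l k i j : Fin d)
    (u : EuclideanSpace ℝ (Fin d)) : ℝ :=
  partialDeriv i (Γ l j k) u - partialDeriv j (Γ l i k) u
    + ∑ m, (Γ l i m u * Γ m j k u - Γ l j m u * Γ m i k u)

/-- The curvature commutes with every endomorphism field that is parallel. -/
theorem curvatureOf_comm_of_parallel (hO : IsOpen O) (hu : u ∈ O)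
    {Γ : Fin d → Fin d → Fin d → EuclideanSpace ℝ (Fin d) → ℝ}
    (hΓ : ∀ k i j, ContDiffOn ℝ ∞ (Γ k i j) O)
    {J : Fin d → Fin d → EuclideanSpace ℝ (Fin d) → ℝ}
    (hJ : ∀ k j, ContDiffOn ℝ ∞ (J k j) O)
    (hpar : ∀ v ∈ O, ∀ k i j, partialDeriv i (J k j) v
      + ∑ m, (Γ k i m v * J m j v - Γ m i j v * J k m v) = 0) (i j : Fin d) :
    (Matrix.of fun l k => curvatureOf Γ l k i j u) * (Matrix.of fun l k => J l k u) =
      (Matrix.of fun l k => J l k u) * Matrix.of fun l k => curvatureOf Γ l k i j u := by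
  have hΓd : ∀ k i j, DifferentiableAt ℝ (Γ k i j) u := fun k i j =>
    (hΓ k i j).differentiableAt_of_isOpen hO hu
  have hJd : ∀ k j, DifferentiableAt ℝ (J k j) u := fun k j =>
    (hJ k j).differentiableAt_of_isOpen hO hu
  let Jm : Matrix (Fin d) (Fin d) ℝ := Matrix.of fun l k => J l k u
  let A : Fin d → Matrix (Fin d) (Fin d) ℝ := fun i => Matrix.of fun k m => Γ k i m u
  let dA : Fin d → Fin d → Matrix (Fin d) (Fin d) ℝ := fun j i =>
    Matrix.of fun k m => partialDeriv j (Γ k i m) u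
  let dJ : Fin d → Matrix (Fin d) (Fin d) ℝ := fun i => Matrix.of fun k m => partialDeriv i (J k m) u
  have hJ1 : ∀ v ∈ O, ∀ k i j, partialDeriv i (J k j) v =
      ∑ m, (J k m v * Γ m i j v - Γ k i m v * J m j v) := fun v hv k i j => by
    have := hpar v hv k i j
    rw [eq_neg_of_add_eq_zero_left this, ← Finset.sum_neg_distrib]
    exact Finset.sum_congr rfl fun m _ => by ring
  -- In matrix form `∂_i J = [J, A_i]` and `R_{ij} = ∂_i A_j - ∂_j A_i + [A_i, A_j]`.
  -- Differentiating the first equation once more, the symmetry of second derivatives becomes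
  -- `[R_{ij}, J] = 0`.
  have hdJ : ∀ i, dJ i = Jm * A i - A i * Jm := fun i => by
    ext k j
    simp [dJ, Jm, A, Matrix.mul_apply, hJ1 u hu, Finset.sum_sub_distrib]
  have hddJ : ∀ i j, (Matrix.of fun k m => partialDeriv j (partialDeriv i (J k m)) u) =
      dJ j * A i + Jm * dA j i - dA j i * Jm - A i * dJ j := fun i j => by
    ext k s
    simp only [Matrix.of_apply, Matrix.sub_apply, Matrix.add_apply, Matrix.mul_apply, dJ, A, Jm, dA]
    rw [partialDeriv_congr hO hu (fun v hv => hJ1 v hv k i s) j, partialDeriv_sum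
      (ψ := fun m v => J k m v * Γ m i s v - Γ k i m v * J m s v)
      (fun m => ((hJd k m).mul (hΓd m i s)).sub ((hΓd k i m).mul (hJd m s))),
      ← Finset.sum_add_distrib, ← Finset.sum_sub_distrib, ← Finset.sum_sub_distrib]
    refine Finset.sum_congr rfl fun m _ => ?_
    rw [partialDeriv_sub (ψ := fun v => J k m v * Γ m i s v) (χ := fun v => Γ k i m v * J m s v)
      ((hJd k m).mul (hΓd m i s)) ((hΓd k i m).mul (hJd m s)),
      partialDeriv_mul (hJd k m) (hΓd m i s), partialDeriv_mul (hΓd k i m) (hJd m s)]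
    ring
  have hsymm : (Matrix.of fun k m => partialDeriv j (partialDeriv i (J k m)) u) =
      Matrix.of fun k m => partialDeriv i (partialDeriv j (J k m)) u := by
    ext k m
    exact partialDeriv_comm hO hu (hJ k m) j i
  have hR : (Matrix.of fun l k => curvatureOf Γ l k i j u) =
      dA i j - dA j i + (A i * A j - A j * A i) := by
    ext l k
    simp [curvatureOf, dA, A, Matrix.mul_apply, Finset.sum_sub_distrib]
  rw [hddJ, hddJ, hdJ, hdJ] at hsymm
  rw [hR]
  change _ * Jm = Jm * _
  rw [← sub_eq_zero] at hsymm ⊢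
  rw [← hsymm]
  noncomm_ring

/-! ### Christoffel symbols of an induced metric and the Gauss equation -/

variable (b : F →L[ℝ] F →L[ℝ] ℝ)
  {φ : EuclideanSpace ℝ (Fin d) → F}
  {G : EuclideanSpace ℝ (Fin d) → Matrix (Fin d) (Fin d) ℝ}

/-- The Christoffel symbols of an induced metric, with the upper index lowered. -/
theorem sum_christoffelOf (hO : IsOpen O) (hφ : ContDiffOn ℝ ∞ φ O)
    (hb : ∀ x y, b x y = b y x)
    (hG : ∀ v ∈ O, ∀ i j, G v i j = b (partialDeriv i φ v) (partialDeriv j φ v))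
    (hdet : ∀ v ∈ O, (G v).det ≠ 0) {v : EuclideanSpace ℝ (Fin d)} (hv : v ∈ O) (m i j : Fin d) :
    ∑ l, G v m l * christoffelOf G l i j v =
      b (partialDeriv i (partialDeriv j φ) v) (partialDeriv m φ v) := by
  have hdiff : ∀ i, DifferentiableAt ℝ (partialDeriv i φ) v := fun i =>
    (contDiffOn_partialDeriv hO hφ i).differentiableAt_of_isOpen hO hv
  have hdG : ∀ i j l, partialDeriv i (fun v => G v j l) v =
      b (partialDeriv i (partialDeriv j φ) v) (partialDeriv l φ v) +
      b (partialDeriv j φ v) (partialDeriv i (partialDeriv l φ) v) := fun i j l => by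
    rw [partialDeriv_congr hO hv (fun w hw => hG w hw j l) i,
      partialDeriv_bilin b (hdiff j) (hdiff l)]
  -- In `∂_i g_{jl} + ∂_j g_{il} - ∂_l g_{ij}` all terms cancel except `2⟨∂_i∂_jφ, ∂_lφ⟩`.
  have hchr : (fun l => christoffelOf G l i j v) = (G v)⁻¹.mulVec
      fun l => b (partialDeriv i (partialDeriv j φ) v) (partialDeriv l φ v) := by
    ext k
    rw [christoffelOf, Finset.mul_sum]
    refine Finset.sum_congr rfl fun l _ => ?_
    rw [hdG, hdG, hdG, partialDeriv_comm hO hv hφ j i, partialDeriv_comm hO hv hφ l i,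
      partialDeriv_comm hO hv hφ l j, hb (partialDeriv j φ v), hb (partialDeriv i φ v)]
    ring
  change ((G v).mulVec fun l => christoffelOf G l i j v) m = _
  rw [hchr, Matrix.mulVec_mulVec, Matrix.mul_nonsing_inv _ (hdet v hv).isUnit, Matrix.one_mulVec]

theorem contDiffOn_christoffelOf (hO : IsOpen O) (hG : ∀ i j, ContDiffOn ℝ ∞ (fun v => G v i j) O)
    (hdet : ∀ v ∈ O, (G v).det ≠ 0) (k i j : Fin d) :
    ContDiffOn ℝ ∞ (christoffelOf G k i j) O :=
  contDiffOn_const.mul <| ContDiffOn.sum fun l _ => (contDiffOn_matrix_inv hG hdet k l).mul <|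
    ((contDiffOn_partialDeriv hO (hG _ _) _).add (contDiffOn_partialDeriv hO (hG _ _) _)).sub
      (contDiffOn_partialDeriv hO (hG _ _) _)

/-- The components `α_{ij} = ∂_i ∂_j φ - Γ^k_{ij} ∂_k φ` of the second fundamental form. -/
noncomputable def secondFundamental (φ : EuclideanSpace ℝ (Fin d) → F)
    (G : EuclideanSpace ℝ (Fin d) → Matrix (Fin d) (Fin d) ℝ) (i j : Fin d)
    (u : EuclideanSpace ℝ (Fin d)) : F :=
  partialDeriv i (partialDeriv j φ) u - ∑ k, christoffelOf G k i j u • partialDeriv k φ u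

/-- The lowered Christoffel symbols are the tangential components of `∂_i∂_jφ`, so subtracting
`Γ^k_{ij} ∂_kφ` leaves the normal part. -/
theorem secondFundamental_normal (hO : IsOpen O) (hφ : ContDiffOn ℝ ∞ φ O)
    (hb : ∀ x y, b x y = b y x)
    (hG : ∀ v ∈ O, ∀ i j, G v i j = b (partialDeriv i φ v) (partialDeriv j φ v))
    (hdet : ∀ v ∈ O, (G v).det ≠ 0) (hu : u ∈ O) (i j m : Fin d) :
    b (secondFundamental φ G i j u) (partialDeriv m φ u) = 0 := by
  rw [secondFundamental, map_sub, sub_apply,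
    ← sum_christoffelOf b hO hφ hb hG hdet hu, map_sum, sum_apply, sub_eq_zero]
  refine Finset.sum_congr rfl fun l _ => ?_
  rw [map_smul, smul_apply, smul_eq_mul, ← hG u hu, mul_comm, hG u hu, hb,
    ← hG u hu]

/-- The Gauss equation in coordinates. -/
theorem gauss_equation (hO : IsOpen O) (hφ : ContDiffOn ℝ ∞ φ O)
    (hb : ∀ x y, b x y = b y x)
    (hG : ∀ v ∈ O, ∀ i j, G v i j = b (partialDeriv i φ v) (partialDeriv j φ v))
    (hGs : ∀ i j, ContDiffOn ℝ ∞ (fun v => G v i j) O)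
    (hdet : ∀ v ∈ O, (G v).det ≠ 0) (hu : u ∈ O) (i j k m : Fin d) :
    ∑ l, G u m l * curvatureOf (christoffelOf G) l k i j u =
      b (secondFundamental φ G j k u) (secondFundamental φ G i m u)
        - b (secondFundamental φ G i k u) (secondFundamental φ G j m u) := by
  have hΓd : ∀ k i j, DifferentiableAt ℝ (christoffelOf G k i j) u := fun k i j =>
    (contDiffOn_christoffelOf hO hGs hdet k i j).differentiableAt_of_isOpen hO hu
  have hGd : ∀ i j, DifferentiableAt ℝ (fun v => G v i j) u := fun i j =>
    (hGs i j).differentiableAt_of_isOpen hO hu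
  have hd1 : ∀ i, DifferentiableAt ℝ (partialDeriv i φ) u := fun i =>
    (contDiffOn_partialDeriv hO hφ i).differentiableAt_of_isOpen hO hu
  have hd2 : ∀ i j, DifferentiableAt ℝ (partialDeriv i (partialDeriv j φ)) u := fun i j =>
    (contDiffOn_partialDeriv hO (contDiffOn_partialDeriv hO hφ j) i).differentiableAt_of_isOpen hO hu
  -- Obtained by applying `∂_i` to `∑ g_{ml} Γ^l_{jk} = ⟨∂_j∂_kφ, ∂_mφ⟩`. The third-derivative term
  -- is symmetric in `i` and `j`, so it disappears when the two halves are subtracted.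
  have half : ∀ i j, ∑ l, G u m l * (partialDeriv i (christoffelOf G l j k) u
      + ∑ s, christoffelOf G l i s u * christoffelOf G s j k u) =
      b (partialDeriv i (partialDeriv j (partialDeriv k φ)) u) (partialDeriv m φ u)
        + b (secondFundamental φ G j k u) (secondFundamental φ G i m u) := fun i j => by
    have h1 := partialDeriv_congr hO hu
      (fun v hv => sum_christoffelOf b hO hφ hb hG hdet hv m j k) i
    rw [partialDeriv_bilin b (hd2 j k) (hd1 m),
      partialDeriv_sum
        (ψ := fun l v => G v m l * christoffelOf G l j k v) (fun l => (hGd m l).mul (hΓd l j k))] at h1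
    have h2 : ∀ l, partialDeriv i (fun v => G v m l * christoffelOf G l j k v) u =
        b (partialDeriv i (partialDeriv m φ) u) (partialDeriv l φ u) * christoffelOf G l j k u
        + (∑ s, G u m s * christoffelOf G s i l u) * christoffelOf G l j k u
        + G u m l * partialDeriv i (christoffelOf G l j k) u := fun l => by
      rw [partialDeriv_mul (hGd m l) (hΓd l j k),
        partialDeriv_congr hO hu (fun w hw => hG w hw m l) i,
        partialDeriv_bilin b (hd1 m) (hd1 l), sum_christoffelOf b hO hφ hb hG hdet hu,
        hb (partialDeriv m φ u)]
      ring
    have h3 : b (secondFundamental φ G j k u) (secondFundamental φ G i m u) =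
        b (partialDeriv j (partialDeriv k φ) u) (partialDeriv i (partialDeriv m φ) u)
        - ∑ l, b (partialDeriv i (partialDeriv m φ) u) (partialDeriv l φ u)
          * christoffelOf G l j k u := by
      conv_lhs => rw [secondFundamental.eq_1 φ G i m u]
      rw [map_sub, map_sum, Finset.sum_eq_zero fun l _ => by
        rw [map_smul, secondFundamental_normal b hO hφ hb hG hdet hu, smul_zero], sub_zero,
        secondFundamental, map_sub, sub_apply, map_sum,
        sum_apply]
      congr 1
      refine Finset.sum_congr rfl fun l _ => ?_
      rw [map_smul, smul_apply, smul_eq_mul, hb, mul_comm]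
    have h4 : ∑ l, (∑ s, G u m s * christoffelOf G s i l u) * christoffelOf G l j k u =
        ∑ l, G u m l * ∑ s, christoffelOf G l i s u * christoffelOf G s j k u := by
      simp only [Finset.sum_mul, Finset.mul_sum]
      rw [Finset.sum_comm]
      exact Finset.sum_congr rfl fun l _ => Finset.sum_congr rfl fun s _ => by ring
    simp only [h2, Finset.sum_add_distrib] at h1
    simp only [mul_add, Finset.sum_add_distrib]
    rw [h3, ← h4]
    linarith
  have hsplit : ∑ l, G u m l * curvatureOf (christoffelOf G) l k i j u =
      ∑ l, G u m l * (partialDeriv i (christoffelOf G l j k) u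
        + ∑ s, christoffelOf G l i s u * christoffelOf G s j k u)
      - ∑ l, G u m l * (partialDeriv j (christoffelOf G l i k) u
        + ∑ s, christoffelOf G l j s u * christoffelOf G s i k u) := by
    rw [← Finset.sum_sub_distrib]
    refine Finset.sum_congr rfl fun l _ => ?_
    rw [curvatureOf, Finset.sum_sub_distrib]
    ring
  rw [hsplit, half, half, partialDeriv_comm hO hu (contDiffOn_partialDeriv hO hφ k) i j]
  ring

end Local

/-! ### Tensors from components; the position vector of the hyperboloid -/

section LocalTensors

variable {d : ℕ} {F : Type*} [NormedAddCommGroup F] [NormedSpace ℝ F]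
  {O : Set (EuclideanSpace ℝ (Fin d))} {u : EuclideanSpace ℝ (Fin d)}
  (b : F →L[ℝ] F →L[ℝ] ℝ)
  {φ : EuclideanSpace ℝ (Fin d) → F}
  {G : EuclideanSpace ℝ (Fin d) → Matrix (Fin d) (Fin d) ℝ}

/-- The bilinear map with the components `a i j`. -/
noncomputable def bilinOfComponents (a : Fin d → Fin d → F) :
    EuclideanSpace ℝ (Fin d) →ₗ[ℝ] EuclideanSpace ℝ (Fin d) →ₗ[ℝ] F :=
  LinearMap.mk₂ ℝ (fun X Y => ∑ i, ∑ j, (X i * Y j) • a i j)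
    (fun X Y Z => by simp [add_mul, add_smul, Finset.sum_add_distrib])
    (fun c X Y => by simp [Finset.smul_sum, smul_smul, mul_assoc])
    (fun X Y Z => by simp [mul_add, add_smul, Finset.sum_add_distrib])
    (fun c X Y => by simp [Finset.smul_sum, smul_smul, mul_left_comm])

theorem bilinOfComponents_apply (a : Fin d → Fin d → F) (X Y : EuclideanSpace ℝ (Fin d)) :
    bilinOfComponents a X Y = ∑ i, ∑ j, (X i * Y j) • a i j := rfl

/-- The coordinate expression `⟨R(X,Y)Z, W⟩`. -/
noncomputable def curvatureForm (G : Matrix (Fin d) (Fin d) ℝ) (R : Fin d → Fin d → Fin d → Fin d → ℝ)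
    (X Y Z W : Fin d → ℝ) : ℝ :=
  ∑ i, ∑ j, ∑ k, ∑ l, ∑ m, G l m * R l k i j * X i * Y j * Z k * W m

theorem curvatureForm_eq_dotProduct (G : Matrix (Fin d) (Fin d) ℝ)
    (R : Fin d → Fin d → Fin d → Fin d → ℝ) (X Y Z W : Fin d → ℝ) :
    curvatureForm G R X Y Z W = ∑ i, ∑ j, X i * Y j *
      ((Matrix.of fun l k => R l k i j).mulVec Z ⬝ᵥ G.mulVec W) := by
  refine Finset.sum_congr rfl fun i _ => Finset.sum_congr rfl fun j _ => ?_
  simp only [dotProduct, Matrix.mulVec, Matrix.of_apply, Finset.sum_mul, Finset.mul_sum]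
  rw [Finset.sum_comm]
  refine Finset.sum_congr rfl fun l _ => ?_
  rw [Finset.sum_comm]
  refine Finset.sum_congr rfl fun m _ => Finset.sum_congr rfl fun k _ => ?_
  ring

/-- A curvature that commutes with an orthogonal endomorphism is invariant under it. -/
theorem curvatureForm_map {G J : Matrix (Fin d) (Fin d) ℝ}
    {R : Fin d → Fin d → Fin d → Fin d → ℝ}
    (hR : ∀ i j, (Matrix.of fun l k => R l k i j) * J = J * Matrix.of fun l k => R l k i j)
    (hJ : J.transpose * G * J = G) (X Y Z W : Fin d → ℝ) :
    curvatureForm G R X Y (J.mulVec Z) (J.mulVec W) = curvatureForm G R X Y Z W := by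
  rw [curvatureForm_eq_dotProduct, curvatureForm_eq_dotProduct]
  refine Finset.sum_congr rfl fun i _ => Finset.sum_congr rfl fun j _ => ?_
  rw [Matrix.mulVec_mulVec, hR, ← Matrix.mulVec_mulVec, ← Matrix.vecMul_transpose J,
    ← Matrix.dotProduct_mulVec, Matrix.mulVec_mulVec, Matrix.mulVec_mulVec, hJ]

/-- The Gauss equation for the bilinear maps with the given components. -/
theorem curvatureForm_eq_of_gauss {G : Matrix (Fin d) (Fin d) ℝ}
    {R : Fin d → Fin d → Fin d → Fin d → ℝ} {a : Fin d → Fin d → F}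
    (hG : ∀ l m, G l m = G m l)
    (h : ∀ i j k m, ∑ l, G m l * R l k i j = b (a j k) (a i m) - b (a i k) (a j m))
    (X Y Z W : EuclideanSpace ℝ (Fin d)) :
    curvatureForm G R X Y Z W =
      b (bilinOfComponents a Y Z) (bilinOfComponents a X W)
        - b (bilinOfComponents a X Z) (bilinOfComponents a Y W) := by
  have hexp : ∀ X Y Z W : EuclideanSpace ℝ (Fin d),
      b (bilinOfComponents a Y Z) (bilinOfComponents a X W) =
      ∑ i, ∑ j, ∑ k, ∑ m, X i * Y j * Z k * W m * b (a j k) (a i m) := fun X Y Z W => by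
    simp only [bilinOfComponents_apply, map_sum, map_smul, sum_apply, smul_apply, smul_eq_mul,
      Finset.mul_sum]
    refine Finset.sum_congr rfl fun i _ => ?_
    rw [Finset.sum_comm]
    refine Finset.sum_congr rfl fun j _ => ?_
    rw [Finset.sum_comm]
    refine Finset.sum_congr rfl fun k _ => Finset.sum_congr rfl fun m _ => ?_
    ring
  have hcomm : b (bilinOfComponents a X Z) (bilinOfComponents a Y W) =
      ∑ i, ∑ j, ∑ k, ∑ m, X i * Y j * Z k * W m * b (a i k) (a j m) := by
    rw [hexp, Finset.sum_comm]
    refine Finset.sum_congr rfl fun i _ => Finset.sum_congr rfl fun j _ =>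
      Finset.sum_congr rfl fun k _ => Finset.sum_congr rfl fun m _ => ?_
    ring
  rw [hexp, hcomm, curvatureForm]
  simp only [← Finset.sum_sub_distrib]
  refine Finset.sum_congr rfl fun i _ => Finset.sum_congr rfl fun j _ =>
    Finset.sum_congr rfl fun k _ => ?_
  rw [Finset.sum_comm]
  refine Finset.sum_congr rfl fun m _ => ?_
  rw [← mul_sub, ← h, Finset.mul_sum]
  refine Finset.sum_congr rfl fun l _ => ?_
  rw [hG l m]; ring

theorem fderiv_eq_sum_partialDeriv (X : EuclideanSpace ℝ (Fin d)) :
    fderiv ℝ φ u X = ∑ i, X i • partialDeriv i φ u := by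
  conv_lhs => rw [← (EuclideanSpace.basisFun (Fin d) ℝ).sum_repr X]
  simp [map_sum, partialDeriv]

theorem secondFundamental_comm (hO : IsOpen O) (hφ : ContDiffOn ℝ ∞ φ O)
    (hb : ∀ x y, b x y = b y x)
    (hG : ∀ v ∈ O, ∀ i j, G v i j = b (partialDeriv i φ v) (partialDeriv j φ v)) (hu : u ∈ O)
    (i j : Fin d) : secondFundamental φ G i j u = secondFundamental φ G j i u := by
  have hΓ : ∀ k, christoffelOf G k i j u = christoffelOf G k j i u := fun k => by
    simp only [christoffelOf]
    congr 1
    refine Finset.sum_congr rfl fun l _ => ?_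
    rw [partialDeriv_congr hO hu (fun v hv => show G v i j = G v j i by
      rw [hG v hv, hG v hv, hb]) l]
    ring
  simp only [secondFundamental, hΓ, partialDeriv_comm hO hu hφ i j]

/-- The position vector of a hyperboloid is normal. -/
theorem bilin_partialDeriv_self (hO : IsOpen O) (hφ : ContDiffOn ℝ ∞ φ O)
    (hb : ∀ x y, b x y = b y x) {c : ℝ} (hc : ∀ v ∈ O, b (φ v) (φ v) = c) (hu : u ∈ O)
    (i : Fin d) : b (partialDeriv i φ u) (φ u) = 0 := by
  have hd := hφ.differentiableAt_of_isOpen hO hu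
  have h := partialDeriv_congr hO hu hc i
  rw [partialDeriv_bilin b hd hd, hb (φ u)] at h
  have h0 : partialDeriv i (fun _ : EuclideanSpace ℝ (Fin d) => c) u = 0 := by
    simp [partialDeriv]
  linarith

/-- Differentiate `⟨∂_jφ, φ⟩ = 0`; the tangential correction in `α` is orthogonal to `φ`. -/
theorem bilin_secondFundamental_self (hO : IsOpen O) (hφ : ContDiffOn ℝ ∞ φ O)
    (hb : ∀ x y, b x y = b y x) {c : ℝ} (hc : ∀ v ∈ O, b (φ v) (φ v) = c) (hu : u ∈ O)
    (i j : Fin d) : b (secondFundamental φ G i j u) (φ u) =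
      -b (partialDeriv i φ u) (partialDeriv j φ u) := by
  have h := partialDeriv_congr hO hu
    (fun v hv => bilin_partialDeriv_self b hO hφ hb hc hv j) i
  rw [partialDeriv_bilin b ((contDiffOn_partialDeriv hO hφ j).differentiableAt_of_isOpen hO hu)
    (hφ.differentiableAt_of_isOpen hO hu)] at h
  have h0 : partialDeriv i (fun _ : EuclideanSpace ℝ (Fin d) => (0 : ℝ)) u = 0 := by
    simp [partialDeriv]
  rw [secondFundamental, map_sub, sub_apply, map_sum, sum_apply, Finset.sum_eq_zero fun k _ => by
    rw [map_smul, smul_apply, bilin_partialDeriv_self b hO hφ hb hc hu, smul_zero],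
    hb (partialDeriv i φ u)]
  rw [hb (partialDeriv j φ u)] at h
  rw [hb (partialDeriv j φ u)]
  linarith

end LocalTensors

/-! ### The nonexistence theorem in a coordinate domain -/

section LocalMain

open Module

/-- The Lorentzian inner product as a continuous bilinear form. -/
noncomputable def lorentzCLM (m : ℕ) : LorentzSpace m →L[ℝ] LorentzSpace m →L[ℝ] ℝ :=
  LinearMap.toContinuousBilinearMap (lorentzForm m)

theorem lorentzCLM_apply {m : ℕ} (v w : LorentzSpace m) : lorentzCLM m v w = lorentzForm m v w :=
  rfl

/-- Local form of the theorem: a Kaehler metric on an open subset of `ℝ^{2n}` that is induced by a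
map to hyperbolic space of dimension less than `3n` has no point at which all holomorphic sectional
curvatures are positive. -/
theorem false_of_local_kaehler {n m : ℕ} (hm : m + 1 ≤ 3 * n)
    {O : Set (EuclideanSpace ℝ (Fin (2 * n)))} (hO : IsOpen O)
    {u : EuclideanSpace ℝ (Fin (2 * n))} (hu : u ∈ O)
    {φ : EuclideanSpace ℝ (Fin (2 * n)) → LorentzSpace m} (hφ : ContDiffOn ℝ ∞ φ O)
    (hhyp : ∀ v ∈ O, lorentzInner (φ v) (φ v) = -1)
    {G : EuclideanSpace ℝ (Fin (2 * n)) → Matrix (Fin (2 * n)) (Fin (2 * n)) ℝ}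
    (hG : ∀ v ∈ O, ∀ i j, G v i j = lorentzInner (partialDeriv i φ v) (partialDeriv j φ v))
    (hpd : ∀ v ∈ O, ∀ X, X ≠ 0 → 0 < lorentzInner (fderiv ℝ φ v X) (fderiv ℝ φ v X))
    {J : Fin (2 * n) → Fin (2 * n) → EuclideanSpace ℝ (Fin (2 * n)) → ℝ}
    (hJ : ∀ k j, ContDiffOn ℝ ∞ (J k j) O)
    (hpar : ∀ v ∈ O, ∀ k i j, partialDeriv i (J k j) v + ∑ m,
      (christoffelOf G k i m v * J m j v - christoffelOf G m i j v * J k m v) = 0)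
    (Ju : End ℝ (EuclideanSpace ℝ (Fin (2 * n))))
    (hJu : ∀ X k, Ju X k = ∑ j, J k j u * X j) (hsq : ∀ X, Ju (Ju X) = -X)
    (horth : ∀ X Y, lorentzInner (fderiv ℝ φ u (Ju X)) (fderiv ℝ φ u (Ju Y)) =
      lorentzInner (fderiv ℝ φ u X) (fderiv ℝ φ u Y))
    (hpos : ∀ X : EuclideanSpace ℝ (Fin (2 * n)), X ≠ 0 → 0 < curvatureForm (G u)
      (fun l k i j => curvatureOf (christoffelOf G) l k i j u) X (Ju X) (Ju X) X) : False := by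
  have hb : ∀ x y, lorentzCLM m x y = lorentzCLM m y x := lorentzForm_comm
  have hGs : ∀ i j, ContDiffOn ℝ ∞ (fun v => G v i j) O := fun i j => by
    refine ContDiffOn.congr ?_ fun v hv => hG v hv i j
    exact ((lorentzCLM m).contDiff.comp_contDiffOn (contDiffOn_partialDeriv hO hφ i)).clm_apply
      (contDiffOn_partialDeriv hO hφ j)
  have hGX : ∀ v ∈ O, ∀ X Y : EuclideanSpace ℝ (Fin (2 * n)),
      lorentzInner (fderiv ℝ φ v X) (fderiv ℝ φ v Y) = (X : Fin (2 * n) → ℝ) ⬝ᵥ (G v).mulVec Y := by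
    intro v hv X Y
    rw [← lorentzForm_apply, fderiv_eq_sum_partialDeriv, fderiv_eq_sum_partialDeriv]
    simp only [map_sum, LinearMap.sum_apply, map_smul, LinearMap.smul_apply, smul_eq_mul,
      dotProduct, Matrix.mulVec, Finset.mul_sum]
    rw [Finset.sum_comm]
    refine Finset.sum_congr rfl fun i _ => Finset.sum_congr rfl fun j _ => ?_
    rw [hG v hv, lorentzForm_apply]
    ring
  have hdet : ∀ v ∈ O, (G v).det ≠ 0 := fun v hv h0 => by
    obtain ⟨x, hx0, hx⟩ := Matrix.exists_mulVec_eq_zero_iff.mpr h0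
    have hX : WithLp.toLp 2 x ≠ 0 := fun h => hx0 (by simpa using h)
    have := hpd v hv _ hX
    rw [hGX v hv] at this
    simp [hx] at this
  set R : Fin (2 * n) → Fin (2 * n) → Fin (2 * n) → Fin (2 * n) → ℝ :=
    fun l k i j => curvatureOf (christoffelOf G) l k i j u
  let Jm : Matrix (Fin (2 * n)) (Fin (2 * n)) ℝ := Matrix.of fun k j => J k j u
  have hJm : ∀ X : EuclideanSpace ℝ (Fin (2 * n)), (Ju X : Fin (2 * n) → ℝ) = Jm.mulVec X :=
    fun X => funext fun k => hJu X k
  have hRJ := curvatureOf_comm_of_parallel hO hu (contDiffOn_christoffelOf hO hGs hdet) hJ hpar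
  -- Orthogonality of `J` as a matrix identity, tested on all vectors `w` and basis vectors.
  have hJG : Jm.transpose * G u * Jm = G u := by
    refine Matrix.ext_of_mulVec_single fun j => ?_
    refine dotProduct_eq _ _ fun w => ?_
    have := horth (WithLp.toLp 2 w) (EuclideanSpace.single j 1)
    rw [hGX u hu, hGX u hu, hJm, hJm] at this
    rw [dotProduct_comm, dotProduct_comm _ w, ← Matrix.mulVec_mulVec, ← Matrix.mulVec_mulVec,
      Matrix.dotProduct_mulVec, Matrix.vecMul_transpose]
    exact this
  let a : Fin (2 * n) → Fin (2 * n) → LorentzSpace m := fun i j => secondFundamental φ G i j u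
  let α := bilinOfComponents a
  have hgauss : ∀ X Y Z W : EuclideanSpace ℝ (Fin (2 * n)), curvatureForm (G u) R X Y Z W =
      lorentzForm m (α Y Z) (α X W) - lorentzForm m (α X Z) (α Y W) :=
    curvatureForm_eq_of_gauss (lorentzCLM m)
      (fun i j => by rw [hG u hu, hG u hu]; exact lorentzForm_comm _ _)
      (gauss_equation (lorentzCLM m) hO hφ hb hG hGs hdet hu)
  have hinv : ∀ X Y Z W : EuclideanSpace ℝ (Fin (2 * n)),
      curvatureForm (G u) R X Y (Ju Z) (Ju W) = curvatureForm (G u) R X Y Z W := fun X Y Z W => by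
    rw [hJm, hJm]
    exact curvatureForm_map hRJ hJG _ _ _ _
  have hαs : ∀ X Y, α X Y = α Y X := fun X Y => by
    simp only [α, bilinOfComponents_apply]
    rw [Finset.sum_comm]
    refine Finset.sum_congr rfl fun i _ => Finset.sum_congr rfl fun j _ => ?_
    rw [mul_comm (X j), show a j i = a i j from
      secondFundamental_comm (lorentzCLM m) hO hφ hb hG hu j i]
  have hnormal := secondFundamental_normal (lorentzCLM m) hO hφ hb hG hdet hu
  have hφt := bilin_partialDeriv_self (lorentzCLM m) hO hφ hb hhyp hu
  have hφa := bilin_secondFundamental_self (G := G) (lorentzCLM m) hO hφ hb hhyp hu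
  simp only [lorentzCLM_apply] at hnormal hφt hφa
  refine false_of_kaehler_gauss_lorentz hm (by simp) Ju hsq (fderiv ℝ φ u).toLinearMap
    (hpd u hu) horth α hαs ?_ ?_ ?_ (φ u) ?_ ?_ ?_
  · intro X Y Z
    simp only [ContinuousLinearMap.coe_coe, fderiv_eq_sum_partialDeriv, α,
      bilinOfComponents_apply, map_sum, LinearMap.sum_apply, map_smul, LinearMap.smul_apply, a,
      hnormal, smul_zero, Finset.sum_const_zero]
  · intro X Y Z W
    -- Invariance is known in the last two slots of the curvature; the pair symmetry of the Gauss
    -- expression moves it to the first two.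
    have h1 := hinv Z W X Y
    rw [hgauss, hgauss, hαs W, hαs Z, hαs Z, hαs W, hαs W X, hαs Z Y, hαs Z X, hαs W Y] at h1
    linarith [lorentzForm_comm (α (Ju X) W) (α (Ju Y) Z)]
  · intro X hX
    have h1 := hpos X hX
    rw [hgauss, lorentzForm_comm (α (Ju X) (Ju X)), hαs (Ju X) X] at h1
    exact h1
  · rw [lorentzForm_apply, hhyp u hu]; norm_num
  · intro X
    rw [ContinuousLinearMap.coe_coe, lorentzForm_comm, fderiv_eq_sum_partialDeriv]
    simp only [map_sum, LinearMap.sum_apply, map_smul, LinearMap.smul_apply, hφt, smul_zero,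
      Finset.sum_const_zero]
  · intro X Y
    simp only [ContinuousLinearMap.coe_coe, fderiv_eq_sum_partialDeriv, α,
      bilinOfComponents_apply, map_sum, LinearMap.sum_apply, map_smul, LinearMap.smul_apply, a,
      hφa, smul_eq_mul, Finset.mul_sum, ← Finset.sum_neg_distrib]
    rw [Finset.sum_comm]
    refine Finset.sum_congr rfl fun i _ => Finset.sum_congr rfl fun j _ => ?_
    ring

end LocalMain

/-! ### Passage to coordinates -/

section Charts

variable {d : ℕ} {M : Type*} [TopologicalSpace M] [ChartedSpace (EuclideanSpace ℝ (Fin d)) M]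
  [IsManifold (𝓡 d) ∞ M]

/-- The differential of the inverse of a chart. -/
noncomputable def chartSymmDeriv (x₀ : M) (u : EuclideanSpace ℝ (Fin d)) :
    EuclideanSpace ℝ (Fin d) →L[ℝ] TangentSpace (𝓡 d) ((extChartAt (𝓡 d) x₀).symm u) :=
  mfderiv 𝓘(ℝ, EuclideanSpace ℝ (Fin d)) (𝓡 d) (extChartAt (𝓡 d) x₀).symm u

theorem mdifferentiableAt_extChartAt_symm {x₀ : M} {u : EuclideanSpace ℝ (Fin d)}
    (hu : u ∈ (extChartAt (𝓡 d) x₀).target) :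
    MDifferentiableAt 𝓘(ℝ, EuclideanSpace ℝ (Fin d)) (𝓡 d) (extChartAt (𝓡 d) x₀).symm u := by
  have := mdifferentiableWithinAt_extChartAt_symm (I := 𝓡 d) hu
  rwa [ModelWithCorners.Boundaryless.range_eq_univ, mdifferentiableWithinAt_univ] at this

theorem coordComp_chartSymmDeriv {x₀ : M} {u : EuclideanSpace ℝ (Fin d)}
    (hu : u ∈ (extChartAt (𝓡 d) x₀).target) (v : EuclideanSpace ℝ (Fin d)) :
    coordComp x₀ (chartSymmDeriv x₀ u v) = v := by
  have := mfderiv_extChartAt_comp_mfderivWithin_extChartAt_symm (I := 𝓡 d) hu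
  rw [ModelWithCorners.Boundaryless.range_eq_univ, mfderivWithin_univ] at this
  exact DFunLike.congr_fun this v

theorem chartSymmDeriv_coordComp {x₀ : M} {u : EuclideanSpace ℝ (Fin d)}
    (hu : u ∈ (extChartAt (𝓡 d) x₀).target)
    (X : TangentSpace (𝓡 d) ((extChartAt (𝓡 d) x₀).symm u)) :
    chartSymmDeriv x₀ u (coordComp x₀ X) = X := by
  have := mfderivWithin_extChartAt_symm_comp_mfderiv_extChartAt (I := 𝓡 d) hu
  rw [ModelWithCorners.Boundaryless.range_eq_univ, mfderivWithin_univ] at this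
  exact DFunLike.congr_fun this X

/-- The tangent space at `p` is identified with the model space through the preferred chart at `p`,
whose differential there is thus the identity. -/
theorem coordComp_self (p : M) (X : TangentSpace (𝓡 d) p) : coordComp p X = X :=
  DFunLike.congr_fun (mfderiv_extChartAt_self (I := 𝓡 d) (x := p)) X

/-- An endomorphism field in the chart at `x₀`. -/
noncomputable def endInChart (J : SmoothEndField d M) (x₀ : M) (u : EuclideanSpace ℝ (Fin d)) :
    EuclideanSpace ℝ (Fin d) →L[ℝ] EuclideanSpace ℝ (Fin d) :=
  (mfderiv (𝓡 d) 𝓘(ℝ, EuclideanSpace ℝ (Fin d)) (extChartAt (𝓡 d) x₀)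
    ((extChartAt (𝓡 d) x₀).symm u)).comp
    ((J ((extChartAt (𝓡 d) x₀).symm u)).comp (chartSymmDeriv x₀ u))

theorem endInChart_apply (J : SmoothEndField d M) (x₀ : M) (u v : EuclideanSpace ℝ (Fin d)) :
    endInChart J x₀ u v =
      coordComp x₀ (J ((extChartAt (𝓡 d) x₀).symm u) (chartSymmDeriv x₀ u v)) := rfl

theorem endInChart_eq_sum (J : SmoothEndField d M) (x₀ : M) (u v : EuclideanSpace ℝ (Fin d))
    (k : Fin d) : endInChart J x₀ u v k = ∑ j, endCoeff J x₀ k j u * v j := by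
  conv_lhs => rw [← (EuclideanSpace.basisFun (Fin d) ℝ).sum_repr v]
  simp only [map_sum, map_smul, EuclideanSpace.basisFun_apply, EuclideanSpace.basisFun_repr,
    WithLp.ofLp_sum, WithLp.ofLp_smul, Finset.sum_apply, Pi.smul_apply, smul_eq_mul]
  exact Finset.sum_congr rfl fun j _ => mul_comm _ _

theorem chartSymmDeriv_endInChart (J : SmoothEndField d M) {x₀ : M}
    {u : EuclideanSpace ℝ (Fin d)} (hu : u ∈ (extChartAt (𝓡 d) x₀).target)
    (v : EuclideanSpace ℝ (Fin d)) :
    chartSymmDeriv x₀ u (endInChart J x₀ u v) =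
      J ((extChartAt (𝓡 d) x₀).symm u) (chartSymmDeriv x₀ u v) := by
  rw [endInChart_apply, chartSymmDeriv_coordComp hu]

theorem chartSymmDeriv_self (p : M) (v : EuclideanSpace ℝ (Fin d)) :
    chartSymmDeriv p (extChartAt (𝓡 d) p p) v = v := by
  have := mfderivWithin_range_extChartAt_symm (I := 𝓡 d) (x := p)
  rw [ModelWithCorners.Boundaryless.range_eq_univ, mfderivWithin_univ] at this
  exact DFunLike.congr_fun this v

theorem endInChart_self (J : SmoothEndField d M) (p : M) (X : TangentSpace (𝓡 d) p) :
    endInChart J p (extChartAt (𝓡 d) p p) X = J p X := by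
  -- The point with the coordinates of `p` equals `p` only propositionally, so the base point is
  -- generalized before substitution.
  have key : ∀ q : M, q = p → ∀ v : EuclideanSpace ℝ (Fin d),
      coordComp p (J q (v : TangentSpace (𝓡 d) q)) = J p v := by
    rintro _ rfl v
    exact coordComp_self _ _
  exact (congrArg (fun w : EuclideanSpace ℝ (Fin d) => coordComp p (J _ w))
    (chartSymmDeriv_self p X)).trans (key _ (extChartAt_to_inv p) X)

/-- Over the chart domain, the trivialization of the endomorphism bundle at `x₀` is conjugation by
the differential of the chart, so it reads `J` as `endInChart`. -/
theorem contDiffOn_endCoeff (J : SmoothEndField d M) (x₀ : M) (k j : Fin d) :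
    ContDiffOn ℝ ∞ (endCoeff J x₀ k j) (extChartAt (𝓡 d) x₀).target := by
  let e := trivializationAt (EuclideanSpace ℝ (Fin d) →L[ℝ] EuclideanSpace ℝ (Fin d))
    (fun x : M => TangentSpace (𝓡 d) x →L[ℝ] TangentSpace (𝓡 d) x) x₀
  have hbase : (extChartAt (𝓡 d) x₀).source ⊆ e.baseSet := by
    intro x hx
    rw [extChartAt_source] at hx
    simp only [e, hom_trivializationAt_baseSet, TangentBundle.trivializationAt_baseSet]
    exact ⟨hx, hx⟩
  have hsm : ContMDiffOn (𝓡 d) 𝓘(ℝ, EuclideanSpace ℝ (Fin d) →L[ℝ] EuclideanSpace ℝ (Fin d)) ∞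
      (fun x => (e ⟨x, J x⟩).2) (extChartAt (𝓡 d) x₀).source :=
    (e.contMDiffOn_section_iff (isOpen_extChartAt_source x₀) hbase).mp J.contMDiff.contMDiffOn
  have hcomp := hsm.comp (contMDiffOn_extChartAt_symm (I := 𝓡 d) (n := ∞) x₀)
    (fun u hu => (extChartAt (𝓡 d) x₀).map_target hu)
  rw [contMDiffOn_iff_contDiffOn] at hcomp
  have hk : ContDiffOn ℝ ∞ (fun u => (EuclideanSpace.proj k : EuclideanSpace ℝ (Fin d) →L[ℝ] ℝ)
      ((e ⟨(extChartAt (𝓡 d) x₀).symm u, J ((extChartAt (𝓡 d) x₀).symm u)⟩).2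
        (EuclideanSpace.single j 1))) (extChartAt (𝓡 d) x₀).target :=
    (EuclideanSpace.proj k : EuclideanSpace ℝ (Fin d) →L[ℝ] ℝ).contDiff.comp_contDiffOn
      (hcomp.clm_apply (g := fun _ => EuclideanSpace.single j (1 : ℝ)) contDiffOn_const)
  refine hk.congr fun u hu => ?_
  have hs : (extChartAt (𝓡 d) x₀).symm u ∈ (chartAt (EuclideanSpace ℝ (Fin d)) x₀).source := by
    rw [← extChartAt_source (𝓡 d)]
    exact (extChartAt (𝓡 d) x₀).map_target hu
  have h2 : (e ⟨(extChartAt (𝓡 d) x₀).symm u, J ((extChartAt (𝓡 d) x₀).symm u)⟩).2 =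
      endInChart J x₀ u := by
    simp only [e, hom_trivializationAt_apply, ContinuousLinearMap.inCoordinates]
    rw [TangentBundle.continuousLinearMapAt_trivializationAt hs,
      TangentBundle.symmL_trivializationAt hs, ModelWithCorners.Boundaryless.range_eq_univ,
      mfderivWithin_univ, (extChartAt (𝓡 d) x₀).right_inv hu]
    rfl
  rw [h2]
  rfl

variable {g : SmoothMetric d M} {m : ℕ} {f : M → HyperbolicSpace m}

/-- In coordinates, an isometric immersion induces the metric. -/
theorem IsIsometricImmersion.lorentzInner_fderiv (hf : IsIsometricImmersion g f) {x₀ : M}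
    {u : EuclideanSpace ℝ (Fin d)} (hu : u ∈ (extChartAt (𝓡 d) x₀).target)
    (v w : EuclideanSpace ℝ (Fin d)) :
    lorentzInner (fderiv ℝ (fun y => (f ((extChartAt (𝓡 d) x₀).symm y) : LorentzSpace m)) u v)
      (fderiv ℝ (fun y => (f ((extChartAt (𝓡 d) x₀).symm y) : LorentzSpace m)) u w) =
      g.inner ((extChartAt (𝓡 d) x₀).symm u) (chartSymmDeriv x₀ u v) (chartSymmDeriv x₀ u w) := by
  have h := mfderiv_comp u ((hf.smooth _).mdifferentiableAt (by simp))
    (mdifferentiableAt_extChartAt_symm hu)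
  rw [mfderiv_eq_fderiv] at h
  rw [← hf.isometric]
  have h' : ∀ v, fderiv ℝ (fun y => (f ((extChartAt (𝓡 d) x₀).symm y) : LorentzSpace m)) u v =
      mfderiv (𝓡 d) 𝓘(ℝ, LorentzSpace m) (fun y => (f y : LorentzSpace m))
        ((extChartAt (𝓡 d) x₀).symm u) (chartSymmDeriv x₀ u v) := fun v =>
    DFunLike.congr_fun h v
  rw [h', h']

theorem IsIsometricImmersion.contDiffOn (hf : IsIsometricImmersion g f) (x₀ : M) :
    ContDiffOn ℝ ∞ (fun y => (f ((extChartAt (𝓡 d) x₀).symm y) : LorentzSpace m))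
      (extChartAt (𝓡 d) x₀).target := by
  rw [← contMDiffOn_iff_contDiffOn]
  exact hf.smooth.comp_contMDiffOn (contMDiffOn_extChartAt_symm x₀)

theorem IsKaehler.inner_self_apply {J : SmoothEndField d M} (hM : IsKaehler g J) (p : M)
    (X : TangentSpace (𝓡 d) p) : g.inner p X (J p X) = 0 := by
  have h := hM.orthogonal p X (J p X)
  rw [hM.sq_eq_neg, map_neg, g.symm] at h
  linarith

/-- The denominator of `K(X,JX)` is `|X|⁴ > 0`, because `JX` is orthogonal to `X` and of the same
length. -/
theorem IsKaehler.riemannTensor_pos {J : SmoothEndField d M} (hM : IsKaehler g J) {p : M}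
    (hp : HasPosHolSecCurvAt g J p) {X : TangentSpace (𝓡 d) p} (hX : X ≠ 0) :
    0 < riemannTensor g p X (J p X) (J p X) X := by
  have h := hp X hX
  have hXX := g.pos p X hX
  rw [sectionalCurvature, hM.orthogonal, hM.inner_self_apply] at h
  refine (div_pos_iff_of_pos_right ?_).mp h
  nlinarith

theorem IsKaehler.curvatureForm_pos {J : SmoothEndField d M} (hM : IsKaehler g J) {p : M}
    (hp : HasPosHolSecCurvAt g J p) {X : EuclideanSpace ℝ (Fin d)} (hX : X ≠ 0) :
    0 < curvatureForm (metricCoeff g p (extChartAt (𝓡 d) p p))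
      (fun l k i j => curvatureOf (christoffelOf (metricCoeff g p)) l k i j (extChartAt (𝓡 d) p p))
      X (endInChart J p (extChartAt (𝓡 d) p p) X) (endInChart J p (extChartAt (𝓡 d) p p) X) X := by
  obtain ⟨Y, rfl⟩ : ∃ Y : TangentSpace (𝓡 d) p, coordComp p Y = X := ⟨X, coordComp_self p X⟩
  have hY : Y ≠ 0 := by
    rintro rfl
    exact hX (map_zero _)
  have hJ : endInChart J p (extChartAt (𝓡 d) p p) (coordComp p Y) = coordComp p (J p Y) :=
    (congrArg _ (coordComp_self p Y)).trans
      ((endInChart_self J p Y).trans (coordComp_self p (J p Y)).symm)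
  rw [hJ]
  exact hM.riemannTensor_pos hp hY

end Charts

/-! ### The global theorem, read in the chart at the given point -/

theorem mainTheorem3 (n : ℕ) (hn : 2 ≤ n) {M : Type*} [TopologicalSpace M]
    [ChartedSpace (EuclideanSpace ℝ (Fin (2 * n))) M] [IsManifold (𝓡 (2 * n)) ∞ M]
    (g : SmoothMetric (2 * n) M) (J : SmoothEndField (2 * n) M) (hM : IsKaehler g J)
    (hpos : ∃ p : M, HasPosHolSecCurvAt g J p) :
    ¬ ∃ f : M → HyperbolicSpace (3 * n - 1), IsIsometricImmersion g f := by
  rintro ⟨f, hf⟩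
  obtain ⟨p, hp⟩ := hpos
  have hu := mem_extChartAt_target (I := 𝓡 (2 * n)) p
  -- The subtraction in `3 * n - 1` is not truncated since `n ≥ 2`, so the ambient Lorentzian
  -- dimension is exactly `3 * n`.
  refine false_of_local_kaehler (by omega) (isOpen_extChartAt_target p) hu (hf.contDiffOn p)
    (fun v _ => (f _).2.1) (G := metricCoeff g p) (fun v hv i j => ?_) (fun v hv X hX => ?_)
    (J := endCoeff J p) (contDiffOn_endCoeff J p) (hM.parallel p)
    (endInChart J p (extChartAt (𝓡 (2 * n)) p p)).toLinearMap (endInChart_eq_sum J p _)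
    (fun X => ?_) (fun X Y => ?_) (fun X hX => ?_)
  · exact (hf.lorentzInner_fderiv hv _ _).symm
  · rw [hf.lorentzInner_fderiv hv]
    refine g.pos _ _ fun h0 => hX ?_
    rw [← coordComp_chartSymmDeriv hv X, h0]
    exact map_zero _
  · rw [ContinuousLinearMap.coe_coe, endInChart_apply, chartSymmDeriv_endInChart J hu,
      hM.sq_eq_neg, ← map_neg, coordComp_chartSymmDeriv hu]
  · rw [ContinuousLinearMap.coe_coe, hf.lorentzInner_fderiv hu, chartSymmDeriv_endInChart J hu,
      chartSymmDeriv_endInChart J hu, hM.orthogonal, hf.lorentzInner_fderiv hu]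
  · exact hM.curvatureForm_pos hp hX
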